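/- Let $\mathcal H_C$ and $\mathcal H_B$ be complex Hilbert spaces (of any dimension) and let $\mathcal H_C\otimes\mathcal H_B$ be their Hilbert space tensor product. A state is a positive bounded operator of trace one, $S(\rho)=-\operatorname{Tr}\rho\log_2\rho\in[0,\infty]$ is its von Neumann entropy (with $0\log_2 0=0$), and for a state $\rho_{CB}$ on $\mathcal H_C\otimes\mathcal H_B$ with $\rho_B=\operatorname{Tr}_C\rho_{CB}$ the conditional quantum entropy is $$S(C|B)_{\rho_{CB}} = S(\rho_{CB})-S(\rho_B),$$ a real number when both entropies are finite (in particular in finite dimension), and in general an extended real number, with $\infty-\infty$ read as $-\infty$. Then $S(C|B)$ is concave: for all states $\rho_1,\rho_2$ on $\mathcal H_C\otimes\mathcal H_B$ and every real $\lambda$ with $0\le\lambda\le1$, $$S(C|B)_{\lambda\rho_1+(1-\lambda)\rho_2}\;\ge\;\lambda\,S(C|B)_{\rho_1}+(1-\lambda)\,S(C|B)_{\rho_2}.$$ Here $0\cdot(\pm\infty)=0$ and $\infty+(-\infty)=-\infty$ on the right-hand side. In particular, if $S((\rho_1)_B)$ and $S((\rho_2)_B)$ are finite, then so is the entropy of the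 $B$-marginal of $\lambda\rho_1+(1-\lambda)\rho_2$, and no indeterminate expression occurs. -/

import Mathlib

open scoped TensorProduct InnerProductSpace

noncomputable section

namespace QInfo

/-- The Hilbert space tensor product: the completion of the algebraic tensor product for the inner
product determined by `⟪x ⊗ y, x' ⊗ y'⟫ = ⟪x, x'⟫ * ⟪y, y'⟫`. -/
abbrev HilbertTensor (C B : Type*) [NormedAddCommGroup C] [InnerProductSpace ℂ C]
    [NormedAddCommGroup B] [InnerProductSpace ℂ B] : Type _ :=
  UniformSpace.Completion (C ⊗[ℂ] B)

section Trace

variable {H : Type*} [NormedAddCommGroup H] [InnerProductSpace ℂ H] [CompleteSpace H]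

variable (H) in
/-- The index set of a fixed orthonormal (Hilbert) basis of `H`. -/
def basisSet : Set H := (exists_hilbertBasis ℂ H).choose

variable (H) in
/-- A fixed orthonormal (Hilbert) basis of `H`. -/
def stdBasis : HilbertBasis (basisSet H) ℂ H := (exists_hilbertBasis ℂ H).choose_spec.choose

/-- The trace, in `[0, ∞]`, of a positive bounded operator. By `trace_eq` below it can be computed
in every orthonormal basis. -/
def trace (A : H →L[ℂ] H) : ENNReal :=
  ∑' i, ENNReal.ofReal (⟪stdBasis H i, A (stdBasis H i)⟫_ℂ).re

/-- States (density operators): positive operators of trace one. -/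
structure IsState (ρ : H →L[ℂ] H) : Prop where
  isPositive : ρ.IsPositive
  trace_eq_one : trace ρ = 1

/-- The von Neumann entropy `S(ρ) = - Tr (ρ log₂ ρ)`, in `[0, ∞]`. The operator `- ρ log₂ ρ` is the
image of `ρ` under the continuous functional calculus for `x ↦ - x log₂ x` (with value `0` at `0`);
it is a positive operator when `ρ` is a state. -/
def entropy (ρ : H →L[ℂ] H) : ENNReal :=
  trace (cfc (fun x : ℝ => -(x * Real.logb 2 x)) ρ)

theorem continuous_neg_mul_logb : Continuous fun x : ℝ => -(x * Real.logb 2 x) := by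
  have h := Real.continuous_mul_log.div_const (Real.log 2)
  refine h.neg.congr fun x => ?_
  simp only [Real.logb, Pi.neg_apply]
  ring

theorem hasSum_norm_sq {ι : Type*} (b : HilbertBasis ι ℂ H) (x : H) :
    ENNReal.ofReal (‖x‖ ^ 2) = ∑' i, ENNReal.ofReal (‖⟪b i, x⟫_ℂ‖ ^ 2) := by
  have h := (b.hasSum_inner_mul_inner x x).mapL Complex.reCLM
  have h2 : ∀ i, Complex.reCLM (⟪x, b i⟫_ℂ * ⟪b i, x⟫_ℂ) = ‖⟪b i, x⟫_ℂ‖ ^ 2 := by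
    intro i
    rw [← inner_conj_symm x (b i), mul_comm, Complex.mul_conj, Complex.normSq_eq_norm_sq]
    simp [← Complex.ofReal_pow]
  simp only [h2] at h
  have h3 : Complex.reCLM ⟪x, x⟫_ℂ = ‖x‖ ^ 2 := by
    rw [inner_self_eq_norm_sq_to_K]; simp [← Complex.ofReal_pow]
  rw [h3] at h
  rw [← h.tsum_eq, ENNReal.ofReal_tsum_of_nonneg (fun i => sq_nonneg _) h.summable]

theorem exists_sqrt {A : H →L[ℂ] H} (hA : A.IsPositive) :
    ∃ R : H →L[ℂ] H, (∀ x y, ⟪R x, y⟫_ℂ = ⟪x, R y⟫_ℂ) ∧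
      ∀ x, (⟪x, A x⟫_ℂ).re = ‖R x‖ ^ 2 := by
  have h0 : 0 ≤ A := by rwa [ContinuousLinearMap.nonneg_iff_isPositive]
  have hR : 0 ≤ CFC.sqrt A := CFC.sqrt_nonneg A
  rw [ContinuousLinearMap.nonneg_iff_isPositive] at hR
  have hs : ∀ x y, ⟪CFC.sqrt A x, y⟫_ℂ = ⟪x, CFC.sqrt A y⟫_ℂ := hR.isSymmetric
  refine ⟨CFC.sqrt A, hs, fun x => ?_⟩
  conv_lhs => rw [← CFC.sqrt_mul_sqrt_self A h0]
  rw [ContinuousLinearMap.mul_apply, ← hs, inner_self_eq_norm_sq_to_K]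
  simp [← Complex.ofReal_pow]

/-- The trace does not depend on the orthonormal basis. -/
theorem trace_eq {A : H →L[ℂ] H} (hA : A.IsPositive) {ι : Type*} (b : HilbertBasis ι ℂ H) :
    trace A = ∑' i, ENNReal.ofReal (⟪b i, A (b i)⟫_ℂ).re := by
  obtain ⟨R, hs, hR⟩ := exists_sqrt hA
  unfold trace
  simp only [hR]
  calc ∑' i, ENNReal.ofReal (‖R (stdBasis H i)‖ ^ 2)
      = ∑' i, ∑' j, ENNReal.ofReal (‖⟪b j, R (stdBasis H i)⟫_ℂ‖ ^ 2) := by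
        simp only [hasSum_norm_sq b]
    _ = ∑' j, ∑' i, ENNReal.ofReal (‖⟪stdBasis H i, R (b j)⟫_ℂ‖ ^ 2) := by
        rw [ENNReal.tsum_comm]
        refine tsum_congr fun j => tsum_congr fun i => ?_
        rw [← hs, ← inner_conj_symm, RCLike.norm_conj]
    _ = ∑' j, ENNReal.ofReal (‖R (b j)‖ ^ 2) := by
        simp only [← hasSum_norm_sq (stdBasis H)]

/-- The norm of a positive operator is at most its trace. -/
theorem enorm_le_trace {A : H →L[ℂ] H} (hA : A.IsPositive) : ‖A‖ₑ ≤ trace A := by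
  by_cases ht : trace A = ⊤
  · simp [ht]
  obtain ⟨R, hs, hR⟩ := exists_sqrt hA
  have h0 : 0 ≤ A := by rwa [ContinuousLinearMap.nonneg_iff_isPositive]
  have key : ∀ x, ‖R x‖ ^ 2 ≤ (trace A).toReal * ‖x‖ ^ 2 := by
    have hunit : ∀ x, ‖x‖ = 1 → ‖R x‖ ^ 2 ≤ (trace A).toReal := by
      intro x hx
      have ho : Orthonormal ℂ ((↑) : ({x} : Set H) → H) := by
        refine ⟨fun i => ?_, fun i j hij => ?_⟩
        · obtain ⟨i, rfl⟩ := i; exact hx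
        · exact absurd (Subsingleton.elim i j) hij
      obtain ⟨w, b, hw, hb⟩ := ho.exists_hilbertBasis_extension
      have hxw : x ∈ w := hw rfl
      rw [← ENNReal.ofReal_le_iff_le_toReal ht, trace_eq hA b]
      refine le_trans ?_ (ENNReal.le_tsum ⟨x, hxw⟩)
      rw [hb, hR]
    intro x
    by_cases hx : x = 0
    · simp [hx]
    have hn : ‖x‖ ≠ 0 := norm_ne_zero_iff.mpr hx
    have := hunit ((‖x‖⁻¹ : ℂ) • x) (by simp [norm_smul, hn])
    rw [map_smul, norm_smul, mul_pow] at this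
    simp only [norm_inv, Complex.norm_real, norm_norm] at this
    rw [inv_pow, inv_mul_le_iff₀ (by positivity)] at this
    linarith
  have hle : ‖A‖ ≤ (trace A).toReal := by
    rw [CStarAlgebra.norm_le_iff_le_algebraMap A ENNReal.toReal_nonneg h0,
      ContinuousLinearMap.le_def, ContinuousLinearMap.isPositive_iff_complex]
    intro x
    have him : ((⟪A x, x⟫_ℂ).re : ℂ) = ⟪A x, x⟫_ℂ :=
      ((ContinuousLinearMap.isPositive_iff_complex A).1 hA x).1
    have h2 : ⟪A x, x⟫_ℂ = ((‖R x‖ ^ 2 : ℝ) : ℂ) := by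
      rw [← him, ← hR x, ← inner_conj_symm, Complex.conj_re]
    have h3 : ⟪(algebraMap ℝ (H →L[ℂ] H) (trace A).toReal - A) x, x⟫_ℂ
        = (((trace A).toReal * ‖x‖ ^ 2 - ‖R x‖ ^ 2 : ℝ) : ℂ) := by
      rw [ContinuousLinearMap.sub_apply, inner_sub_left, h2, Algebra.algebraMap_eq_smul_one,
        ContinuousLinearMap.smul_apply, ContinuousLinearMap.one_apply,
        ← Complex.coe_smul, inner_smul_left, inner_self_eq_norm_sq_to_K]
      simp
    rw [h3]
    refine ⟨rfl, ?_⟩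
    have := key x
    simp only [RCLike.re_to_complex, Complex.ofReal_re]
    linarith
  rw [← ENNReal.ofReal_toReal ht, ← ofReal_norm_eq_enorm]
  exact ENNReal.ofReal_le_ofReal hle

end Trace

section PartialTrace

variable {C B : Type*} [NormedAddCommGroup C] [InnerProductSpace ℂ C] [CompleteSpace C]
  [NormedAddCommGroup B] [InnerProductSpace ℂ B] [CompleteSpace B]

/-- The operator `B → C ⊗ B`, `y ↦ c ⊗ y`. -/
def tensorLeft (c : C) : B →L[ℂ] HilbertTensor C B :=
  (UniformSpace.Completion.toComplL : (C ⊗[ℂ] B) →L[ℂ] HilbertTensor C B) ∘L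
    TensorProduct.mkL ℂ C B c

/-- The operator `C → C ⊗ B`, `c ↦ c ⊗ y`. -/
def tensorRight (y : B) : C →L[ℂ] HilbertTensor C B :=
  (UniformSpace.Completion.toComplL : (C ⊗[ℂ] B) →L[ℂ] HilbertTensor C B) ∘L
    (TensorProduct.mkL ℂ C B).flip y

theorem tensorRight_apply (c : C) (y : B) : tensorRight y c = tensorLeft c y := rfl

/-- The compression `⟨c| ρ |c⟩` of an operator on `C ⊗ B` to an operator on `B`. -/
def compress (ρ : HilbertTensor C B →L[ℂ] HilbertTensor C B) (c : C) : B →L[ℂ] B :=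
  (tensorLeft c).adjoint ∘L ρ ∘L tensorLeft c

theorem inner_tensorLeft (c c' : C) (y y' : B) :
    ⟪tensorLeft c y, tensorLeft c' y'⟫_ℂ = ⟪c, c'⟫_ℂ * ⟪y, y'⟫_ℂ := by
  simp [tensorLeft, TensorProduct.mkL_apply_apply]

theorem inner_compress (ρ : HilbertTensor C B →L[ℂ] HilbertTensor C B) (c : C) (x y : B) :
    ⟪x, compress ρ c y⟫_ℂ = ⟪tensorLeft c x, ρ (tensorLeft c y)⟫_ℂ := by
  simp [compress, ContinuousLinearMap.adjoint_inner_right]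

theorem isPositive_compress {ρ : HilbertTensor C B →L[ℂ] HilbertTensor C B} (hρ : ρ.IsPositive)
    (c : C) : (compress ρ c).IsPositive :=
  hρ.adjoint_conj (tensorLeft c)

/-- The product of two orthonormal bases is an orthonormal basis of the Hilbert tensor product. -/
theorem exists_productBasis {ι κ : Type*} (b : HilbertBasis ι ℂ C) (d : HilbertBasis κ ℂ B) :
    ∃ p : HilbertBasis (ι × κ) ℂ (HilbertTensor C B),
      ∀ q, p q = tensorLeft (b q.1) (d q.2) := by
  classical
  have ho : Orthonormal ℂ (fun q : ι × κ => tensorLeft (b q.1) (d q.2)) := by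
    rw [orthonormal_iff_ite]
    rintro ⟨i, j⟩ ⟨i', j'⟩
    rw [inner_tensorLeft, orthonormal_iff_ite.1 b.orthonormal, orthonormal_iff_ite.1 d.orthonormal]
    by_cases h1 : i = i' <;> by_cases h2 : j = j' <;> simp [h1, h2]
  refine ⟨HilbertBasis.mkOfOrthogonalEqBot ho ?_, fun q => by rw [HilbertBasis.coe_mkOfOrthogonalEqBot]⟩
  rw [Submodule.eq_bot_iff]
  intro v hv
  have h0 : ∀ i j, ⟪tensorLeft (b i) (d j), v⟫_ℂ = 0 := fun i j =>
    (Submodule.mem_orthogonal _ _).1 hv _ (Submodule.subset_span ⟨(i, j), rfl⟩)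
  have h1 : ∀ i y, ⟪tensorLeft (b i) y, v⟫_ℂ = 0 := by
    intro i y
    have hw : (tensorLeft (b i)).adjoint v = 0 := by
      apply d.repr.injective
      ext j
      simp [HilbertBasis.repr_apply_apply, ContinuousLinearMap.adjoint_inner_right, h0]
    rw [← ContinuousLinearMap.adjoint_inner_right, hw, inner_zero_right]
  have h2 : ∀ c y, ⟪tensorLeft c y, v⟫_ℂ = 0 := by
    intro c y
    have hw : (tensorRight y).adjoint v = 0 := by
      apply b.repr.injective
      ext j
      simp [HilbertBasis.repr_apply_apply, ContinuousLinearMap.adjoint_inner_right,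
        tensorRight_apply, h1]
    rw [← tensorRight_apply, ← ContinuousLinearMap.adjoint_inner_right, hw, inner_zero_right]
  have h3 : ∀ t : C ⊗[ℂ] B, ⟪(t : HilbertTensor C B), v⟫_ℂ = 0 := by
    intro t
    induction t using TensorProduct.induction_on with
    | zero => rw [UniformSpace.Completion.coe_zero, inner_zero_left]
    | tmul c y => exact h2 c y
    | add s t hs ht => rw [UniformSpace.Completion.coe_add, inner_add_left, hs, ht, add_zero]
  have h4 : ∀ w : HilbertTensor C B, ⟪w, v⟫_ℂ = 0 := fun w =>
    UniformSpace.Completion.induction_on w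
      (isClosed_eq (by fun_prop) (by fun_prop)) h3
  exact inner_self_eq_zero.1 (h4 v)

theorem tsum_trace_compress {ρ : HilbertTensor C B →L[ℂ] HilbertTensor C B} (hρ : ρ.IsPositive)
    {ι : Type*} (b : HilbertBasis ι ℂ C) : ∑' i, trace (compress ρ (b i)) = trace ρ := by
  obtain ⟨p, hp⟩ := exists_productBasis b (stdBasis B)
  rw [trace_eq hρ p, ENNReal.tsum_prod']
  simp only [hp]
  refine tsum_congr fun i => ?_
  rw [trace_eq (isPositive_compress hρ _) (stdBasis B)]
  simp only [inner_compress]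

theorem summable_compress {ρ : HilbertTensor C B →L[ℂ] HilbertTensor C B} (hρ : ρ.IsPositive)
    (ht : trace ρ ≠ ⊤) {ι : Type*} (b : HilbertBasis ι ℂ C) :
    Summable fun i => compress ρ (b i) := by
  have h : ∑' i, trace (compress ρ (b i)) ≠ ⊤ := by rwa [tsum_trace_compress hρ b]
  refine Summable.of_norm_bounded (ENNReal.summable_toReal h) fun i => ?_
  rw [← toReal_enorm]
  exact ENNReal.toReal_mono (ENNReal.ne_top_of_tsum_ne_top h i)
    (enorm_le_trace (isPositive_compress hρ _))

/-- The partial trace over `C`, `Tr_C ρ = ∑ᵢ ⟨eᵢ| ρ |eᵢ⟩` for an orthonormal basis `(eᵢ)` of `C`;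
for positive `ρ` of finite trace the series converges in the operator norm
(`hasSum_partialTrace`) and its sum does not depend on the orthonormal basis. -/
def partialTrace (ρ : HilbertTensor C B →L[ℂ] HilbertTensor C B) : B →L[ℂ] B :=
  ∑' i, compress ρ (stdBasis C i)

theorem hasSum_inner_compress {ρ : HilbertTensor C B →L[ℂ] HilbertTensor C B} {ι : Type*}
    {c : ι → C} {R : B →L[ℂ] B} (h : HasSum (fun i => compress ρ (c i)) R) (x y : B) :
    HasSum (fun i => ⟪x, compress ρ (c i) y⟫_ℂ) ⟪x, R y⟫_ℂ :=
  h.mapL ((innerSL ℂ x) ∘L (ContinuousLinearMap.apply ℂ B y))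

theorem inner_tsum_compress {ρ : HilbertTensor C B →L[ℂ] HilbertTensor C B} (hρ : ρ.IsPositive)
    (ht : trace ρ ≠ ⊤) {ι : Type*} (b : HilbertBasis ι ℂ C) (y : B) :
    ⟪y, (∑' i, compress ρ (b i)) y⟫_ℂ =
      ((trace ((tensorRight y).adjoint ∘L ρ ∘L tensorRight y)).toReal : ℂ) := by
  have hsum := hasSum_inner_compress (summable_compress hρ ht b).hasSum y y
  have hnn : ∀ i, 0 ≤ (⟪y, compress ρ (b i) y⟫_ℂ).re := fun i =>
    (isPositive_compress hρ (b i)).re_inner_nonneg_right y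
  have hre : HasSum (fun i => (⟪y, compress ρ (b i) y⟫_ℂ).re)
      (⟪y, (∑' i, compress ρ (b i)) y⟫_ℂ).re := hsum.mapL Complex.reCLM
  have hofReal : ∀ i, ((⟪y, compress ρ (b i) y⟫_ℂ).re : ℂ) = ⟪y, compress ρ (b i) y⟫_ℂ := by
    intro i
    have := (isPositive_compress hρ (b i)).inner_nonneg_right y
    exact Complex.ext rfl (Complex.le_def.1 this).2
  have h1 : ⟪y, (∑' i, compress ρ (b i)) y⟫_ℂ =
      ((⟪y, (∑' i, compress ρ (b i)) y⟫_ℂ).re : ℂ) := by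
    refine hsum.unique ?_
    have := Complex.hasSum_ofReal.2 hre
    simpa only [hofReal] using this
  have h2 : trace ((tensorRight y).adjoint ∘L ρ ∘L tensorRight y) =
      ENNReal.ofReal (⟪y, (∑' i, compress ρ (b i)) y⟫_ℂ).re := by
    rw [trace_eq (hρ.adjoint_conj (tensorRight y)) b, ← hre.tsum_eq,
      ENNReal.ofReal_tsum_of_nonneg hnn hre.summable]
    simp [inner_compress, ContinuousLinearMap.adjoint_inner_right, tensorRight_apply]
  rw [h2, ENNReal.toReal_ofReal (hre.nonneg hnn)]
  exact h1

/-- The series defining the partial trace converges in norm, and to the same operator for every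
orthonormal basis. -/
theorem hasSum_partialTrace {ρ : HilbertTensor C B →L[ℂ] HilbertTensor C B} (hρ : ρ.IsPositive)
    (ht : trace ρ ≠ ⊤) {ι : Type*} (b : HilbertBasis ι ℂ C) :
    HasSum (fun i => compress ρ (b i)) (partialTrace ρ) := by
  have hb := (summable_compress hρ ht b).hasSum
  suffices h : ∑' i, compress ρ (b i) = partialTrace ρ by rwa [h] at hb
  apply ContinuousLinearMap.coe_injective
  rw [← ext_inner_map]
  intro y
  rw [← inner_conj_symm, ← inner_conj_symm _ y]
  congr 1
  exact (inner_tsum_compress hρ ht b y).trans (inner_tsum_compress hρ ht (stdBasis C) y).symm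

/-- The partial trace of a state is a state. -/
theorem IsState.partialTrace {ρ : HilbertTensor C B →L[ℂ] HilbertTensor C B} (hρ : IsState ρ) :
    IsState (partialTrace ρ) := by
  have ht : trace ρ ≠ ⊤ := by simp [hρ.trace_eq_one]
  have hs := hasSum_partialTrace hρ.isPositive ht (stdBasis C)
  have hpos : (QInfo.partialTrace ρ).IsPositive := by
    rw [ContinuousLinearMap.isPositive_iff_complex]
    intro y
    have h : ⟪QInfo.partialTrace ρ y, y⟫_ℂ =
        ((trace ((tensorRight y).adjoint ∘L ρ ∘L tensorRight y)).toReal : ℂ) := by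
      rw [← inner_conj_symm]
      exact (congrArg _ (inner_tsum_compress hρ.isPositive ht (stdBasis C) y)).trans
        (Complex.conj_ofReal _)
    rw [h]
    exact ⟨rfl, ENNReal.toReal_nonneg⟩
  refine ⟨hpos, ?_⟩
  rw [← hρ.trace_eq_one, ← tsum_trace_compress hρ.isPositive (stdBasis C)]
  unfold trace
  rw [ENNReal.tsum_comm]
  refine tsum_congr fun j => ?_
  have hre : HasSum (fun i => (⟪stdBasis B j, compress ρ (stdBasis C i) (stdBasis B j)⟫_ℂ).re)
      (⟪stdBasis B j, QInfo.partialTrace ρ (stdBasis B j)⟫_ℂ).re :=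
    (hasSum_inner_compress hs _ _).mapL Complex.reCLM
  rw [← hre.tsum_eq, ENNReal.ofReal_tsum_of_nonneg _ hre.summable]
  exact fun i => (isPositive_compress hρ.isPositive _).re_inner_nonneg_right _

/-- The conditional quantum entropy `S(C|B) = S(ρ) - S(Tr_C ρ)` of a state `ρ` on `C ⊗ B`, as an
extended real number. -/
def condEntropy (ρ : HilbertTensor C B →L[ℂ] HilbertTensor C B) : EReal :=
  (entropy ρ : EReal) - (entropy (partialTrace ρ) : EReal)

end PartialTrace

end QInfo

end

/-! Concavity follows from the monotonicity of relative entropy under the partial trace. Put `ρ = l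
ρ₁ + m ρ₂`. Since `ρ` is linear in the `ρᵢ`, the weighted sum of the cross entropies `-Tr ρᵢ log ρ`
is `S(ρ)` (`crossEntropy_mix`), and likewise for the marginals. Averaging `S(ρᵢ) - Tr ρᵢ_B log ρ_B ≤
S(ρᵢ_B) - Tr ρᵢ log ρ` therefore gives the claim. All inequalities are kept additive in `[0, ∞]`, so
that infinite entropies never have to be subtracted.

Monotonicity comes from a quadratic variational principle. Let `A`, `D` have eigenvalues `p i`, `q
j`, and let `w i j` be the squared overlaps of their eigenvectors. For `s > 0`, the sum of `w p q /
(p + s q)` is the infimum over `X` of `s⁻¹ Tr X A X† + Tr (1 - X)† D (1 - X)`. It is bounded above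
by every `X` (`tsum_le_trace_add_trace`) and approached by `X` of finite rank
(`exists_trace_add_trace_le`). If `X` acts on `B`, then `1 ⊗ X` gives the same two traces for the
global operators as `X` gives for the marginals, so the infimum can only grow under the partial
trace (`Dominates`).

Integrating over `s` in `(0, T]` turns the sum into that of `w p (log (p + T q) - log p)`. Up to
`log T`, this tends to minus the relative entropy as `T → ∞`.

Finiteness of the entropy of a mixture uses the same principle: `l A ≤ D` bounds the cross entropy
of `A` and `D` by that of `A` and `l A`, which is `S(A) - log₂ l`. -/

noncomputable section

namespace QInfo

/-! ### Spectral decomposition of positive trace-class operators -/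

section Diagonalization

universe u

variable {H : Type u} [NormedAddCommGroup H] [InnerProductSpace ℂ H] [CompleteSpace H]

/-- A Hilbert space has an orthonormal basis of eigenvectors of any compact symmetric operator. -/
theorem exists_hilbertBasis_eigenvectors {A : H →L[ℂ] H} (hc : IsCompactOperator A)
    (hs : A.IsSymmetric) :
    ∃ (ι : Type u) (b : HilbertBasis ι ℂ H) (μ : ι → ℂ), ∀ i, A (b i) = μ i • b i := by
  let E : ℂ → Submodule ℂ H := fun μ => Module.End.eigenspace (A : Module.End ℂ H) μ
  have hE : ∀ μ x, x ∈ E μ ↔ A x = μ • x := fun μ x => Module.End.mem_eigenspace_iff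
  have hcl : ∀ μ, IsClosed (E μ : Set H) := fun μ => by
    have : (E μ : Set H) = {x | A x = μ • x} := Set.ext fun x => hE μ x
    rw [this]
    exact isClosed_eq A.continuous (continuous_const_smul μ)
  have : ∀ μ, CompleteSpace (E μ) := fun μ => (hcl μ).completeSpace_coe
  have ho : Orthonormal ℂ (fun a : Σ μ, basisSet (E μ) => ((stdBasis (E a.1) a.2 : E a.1) : H)) :=
    hs.orthogonalFamily_eigenspaces.orthonormal_sigma_orthonormal
      (v_family := fun μ => stdBasis (E μ)) fun μ => (stdBasis (E μ)).orthonormal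
  refine ⟨_, HilbertBasis.mkOfOrthogonalEqBot ho ?_, fun a => a.1, ?_⟩
  · rw [eq_bot_iff, ← ContinuousLinearMap.orthogonalComplement_iSup_eigenspaces_eq_bot hc hs]
    intro v hv
    rw [← Submodule.iInf_orthogonal, Submodule.mem_iInf]
    intro μ x hx
    -- The adjoint of the inclusion is the orthogonal projection onto the eigenspace; it kills `v`
    -- because `v` is orthogonal to a basis of that eigenspace.
    have hw : (E μ).subtypeL.adjoint v = 0 := by
      apply (stdBasis (E μ)).repr.injective
      ext j
      rw [HilbertBasis.repr_apply_apply, ContinuousLinearMap.adjoint_inner_right]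
      simpa using (Submodule.mem_orthogonal _ _).1 hv _ (Submodule.subset_span ⟨⟨μ, j⟩, rfl⟩)
    have h1 := ContinuousLinearMap.adjoint_inner_right (E μ).subtypeL ⟨x, hx⟩ v
    rw [hw, inner_zero_right] at h1
    exact h1.symm
  · intro a
    rw [HilbertBasis.coe_mkOfOrthogonalEqBot]
    exact (hE _ _).1 (stdBasis (E a.1) a.2).2

theorem mem_spectrum_of_eigenvector {A : H →L[ℂ] H} {x : H} (hx : x ≠ 0) {p : ℝ}
    (h : A x = (p : ℂ) • x) : p ∈ spectrum ℝ A := by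
  intro hu
  obtain ⟨u, hu⟩ := hu
  apply hx
  have h1 : (u : H →L[ℂ] H) x = 0 := by
    rw [hu, Algebra.algebraMap_eq_smul_one]
    simp [h]
  calc x = (((u⁻¹ : (H →L[ℂ] H)ˣ) : H →L[ℂ] H) * (u : H →L[ℂ] H)) x := by simp
    _ = 0 := by rw [ContinuousLinearMap.mul_def, ContinuousLinearMap.comp_apply, h1, map_zero]

/-- Clear for polynomials, hence for all continuous functions on the spectrum by Stone–Weierstrass,
both sides being continuous in the function. -/
theorem cfc_apply_eigenvector {A : H →L[ℂ] H} (hA : IsSelfAdjoint A) {f : ℝ → ℝ}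
    (hf : Continuous f) {x : H} {p : ℝ} (h : A x = (p : ℂ) • x) :
    cfc f A x = (f p : ℂ) • x := by
  by_cases hx : x = 0
  · simp [hx]
  have hp := mem_spectrum_of_eigenvector hx h
  rw [cfc_apply f A hA hf.continuousOn]
  suffices H : ∀ g : C(spectrum ℝ A, ℝ), cfcHom hA g x = (g ⟨p, hp⟩ : ℂ) • x from H _
  intro g
  induction g using ContinuousMap.induction_on_of_compact with
  | const r =>
    have : ContinuousMap.const (spectrum ℝ A) r = algebraMap ℝ _ r := rfl
    rw [this, AlgHomClass.commutes, Algebra.algebraMap_eq_smul_one]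
    simp
  | id => rw [cfcHom_id]; simpa using h
  | star_id => rw [star_trivial, cfcHom_id]; simpa using h
  | add f g hf hg => simp [hf, hg, add_smul]
  | mul f g hf hg =>
    rw [map_mul, ContinuousLinearMap.mul_def, ContinuousLinearMap.comp_apply, hg, map_smul, hf,
      smul_smul]
    simp [mul_comm]
  | frequently f hf =>
    have hcl : IsClosed {g : C(spectrum ℝ A, ℝ) | cfcHom hA g x = (g ⟨p, hp⟩ : ℂ) • x} := by
      refine isClosed_eq ?_ ?_
      · exact (ContinuousLinearMap.apply ℂ H x).continuous.comp (cfcHom_continuous hA)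
      · exact (Complex.continuous_ofReal.comp (continuous_eval_const
          (F := C(spectrum ℝ A, ℝ)) _)).smul continuous_const
    exact hcl.mem_of_frequently_of_tendsto hf Filter.tendsto_id

open scoped Classical in
/-- A positive operator of finite trace is compact. -/
theorem isCompactOperator_of_trace_ne_top {A : H →L[ℂ] H} (hA : A.IsPositive)
    (ht : trace A ≠ ⊤) : IsCompactOperator A := by
  obtain ⟨R, hs, hR⟩ := exists_sqrt hA
  -- It is enough to treat the square root `R`, which is Hilbert–Schmidt: the sum of the `‖R (b i)‖
  -- ^ 2` is the trace of `A`.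
  have hAR : A = R ∘L R := by
    apply ContinuousLinearMap.coe_injective
    rw [← ext_inner_map]
    intro x
    have h1 : ((⟪A x, x⟫_ℂ).re : ℂ) = ⟪A x, x⟫_ℂ :=
      ((ContinuousLinearMap.isPositive_iff_complex A).1 hA x).1
    have h2 : (⟪A x, x⟫_ℂ).re = ‖R x‖ ^ 2 := by
      rw [← hR x, ← inner_conj_symm, Complex.conj_re]
    change ⟪A x, x⟫_ℂ = ⟪R (R x), x⟫_ℂ
    rw [← h1, h2, hs, inner_self_eq_norm_sq_to_K]
    simp
  suffices hRc : IsCompactOperator R by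
    rw [hAR]
    exact hRc.comp_clm R
  set b := stdBasis H
  have hsum : Summable fun i => ‖R (b i)‖ ^ 2 := by
    have h1 : ∑' i, ENNReal.ofReal (‖R (b i)‖ ^ 2) ≠ ⊤ := by
      simpa only [trace, hR] using ht
    have h2 := ENNReal.summable_toReal h1
    simpa only [ENNReal.toReal_ofReal (sq_nonneg _)] using h2
  -- `F s` is `R` followed by the projection onto the span of the `b i`, `i ∈ s`; the norm of `F s -
  -- R` is at most the square root of the tail of the Hilbert–Schmidt sum.
  let F : Finset (basisSet H) → H →L[ℂ] H := fun s =>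
    ∑ i ∈ s, InnerProductSpace.rankOne ℂ (b i) (R (b i))
  have hF : ∀ s, IsCompactOperator (F s) := by
    intro s
    refine (Submodule.sum_mem (compactOperator (RingHom.id ℂ) H H) fun i _ => ?_ :
      F s ∈ compactOperator (RingHom.id ℂ) H H)
    change IsCompactOperator (InnerProductSpace.rankOne ℂ (b i) (R (b i)))
    rw [InnerProductSpace.rankOne_def']
    exact (isCompactOperator_of_locallyCompactSpace_rng
      (ContinuousLinearMap.toSpanSingleton ℂ (b i))).comp_clm _
  refine isCompactOperator_of_tendsto (l := Filter.atTop) (F := F) ?_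
    (Filter.Eventually.of_forall hF)
  rw [tendsto_iff_norm_sub_tendsto_zero]
  have htail := tendsto_tsum_compl_atTop_zero fun i => ‖R (b i)‖ ^ 2
  have hsq := htail.sqrt
  rw [Real.sqrt_zero] at hsq
  refine squeeze_zero (fun _ => norm_nonneg _) (fun s => ?_) hsq
  refine ContinuousLinearMap.opNorm_le_bound _ (Real.sqrt_nonneg _) fun x => ?_
  have hcoef : ∀ j, ⟪b j, (F s - R) x⟫_ℂ = if j ∈ s then 0 else -⟪R (b j), x⟫_ℂ := by
    intro j
    have hb := orthonormal_iff_ite.1 b.orthonormal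
    simp only [F, sub_apply, sum_apply,
      InnerProductSpace.rankOne_apply, inner_sub_right, inner_sum, inner_smul_right, hb, ← hs]
    by_cases hj : j ∈ s <;> simp [hj]
  have hP : ‖(F s - R) x‖ ^ 2 ≤ (∑' i : {i // i ∉ s}, ‖R (b i)‖ ^ 2) * ‖x‖ ^ 2 := by
    have h1 := hasSum_norm_sq b ((F s - R) x)
    simp only [hcoef] at h1
    have h2 : ∑' i, ENNReal.ofReal (‖if i ∈ s then 0 else -⟪R (b i), x⟫_ℂ‖ ^ 2) =
        ∑' i : {i // i ∉ s}, ENNReal.ofReal (‖⟪R (b i), x⟫_ℂ‖ ^ 2) := by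
      change _ = ∑' i : ({i | i ∉ s} : Set (basisSet H)), ENNReal.ofReal (‖⟪R (b i), x⟫_ℂ‖ ^ 2)
      rw [tsum_subtype {i | i ∉ s} fun i => ENNReal.ofReal (‖⟪R (b i), x⟫_ℂ‖ ^ 2)]
      refine tsum_congr fun i => ?_
      by_cases hi : i ∈ s <;> simp [hi]
    have hsum' : Summable fun i : {i // i ∉ s} => ‖R (b i)‖ ^ 2 * ‖x‖ ^ 2 :=
      (hsum.comp_injective Subtype.val_injective).mul_right _
    have h3 : ∑' i : {i // i ∉ s}, ENNReal.ofReal (‖⟪R (b i), x⟫_ℂ‖ ^ 2) ≤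
        ENNReal.ofReal ((∑' i : {i // i ∉ s}, ‖R (b i)‖ ^ 2) * ‖x‖ ^ 2) := by
      rw [← tsum_mul_right, ENNReal.ofReal_tsum_of_nonneg (fun i => by positivity) hsum']
      refine ENNReal.tsum_le_tsum fun i => ENNReal.ofReal_le_ofReal ?_
      rw [← mul_pow]
      gcongr
      exact norm_inner_le_norm _ _
    rw [← h2, ← h1] at h3
    refine (ENNReal.ofReal_le_ofReal_iff ?_).1 h3
    exact mul_nonneg (tsum_nonneg fun _ => sq_nonneg _) (sq_nonneg _)
  rw [← Real.sqrt_sq (norm_nonneg ((F s - R) x)), ← Real.sqrt_sq (norm_nonneg x),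
    ← Real.sqrt_mul (tsum_nonneg fun _ => sq_nonneg _)]
  exact Real.sqrt_le_sqrt hP

/-- `b` is an orthonormal basis of eigenvectors of `A`, with eigenvalues `p i ≥ 0`. -/
structure IsEigenbasis {ι : Type*} (A : H →L[ℂ] H) (b : HilbertBasis ι ℂ H) (p : ι → ℝ) : Prop where
  nonneg : ∀ i, 0 ≤ p i
  apply_eq : ∀ i, A (b i) = (p i : ℂ) • b i

/-- A positive operator of finite trace is diagonal in some orthonormal basis. -/
theorem exists_isEigenbasis {A : H →L[ℂ] H} (hA : A.IsPositive) (ht : trace A ≠ ⊤) :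
    ∃ (ι : Type u) (b : HilbertBasis ι ℂ H) (p : ι → ℝ), IsEigenbasis A b p := by
  obtain ⟨ι, b, μ, h⟩ := exists_hilbertBasis_eigenvectors
    (isCompactOperator_of_trace_ne_top hA ht) hA.isSymmetric
  have hμ : ∀ i, 0 ≤ (μ i).re ∧ ((μ i).re : ℂ) = μ i := fun i => by
    have h1 := (ContinuousLinearMap.isPositive_iff_complex A).1 hA (b i)
    rw [h, inner_smul_left, inner_self_eq_norm_sq_to_K, b.orthonormal.1 i] at h1
    have h2 := congrArg (starRingEnd ℂ) h1.1
    simp only [RCLike.re_to_complex, RCLike.ofReal_one, one_pow, mul_one, Complex.conj_re,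
      Complex.conj_ofReal, Complex.conj_conj] at h1 h2
    exact ⟨h1.2, h2⟩
  exact ⟨ι, b, fun i => (μ i).re, fun i => (hμ i).1, fun i => by rw [h, (hμ i).2]⟩

theorem IsState.trace_ne_top {A : H →L[ℂ] H} (hA : IsState A) : trace A ≠ ⊤ :=
  hA.trace_eq_one.trans_ne ENNReal.one_ne_top

theorem IsState.exists_isEigenbasis {A : H →L[ℂ] H} (hA : IsState A) :
    ∃ (ι : Type u) (b : HilbertBasis ι ℂ H) (p : ι → ℝ), IsEigenbasis A b p :=
  QInfo.exists_isEigenbasis hA.isPositive hA.trace_ne_top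

theorem IsState.re_inner_nonneg {A : H →L[ℂ] H} (hA : IsState A) (x : H) :
    0 ≤ (⟪x, A x⟫_ℂ).re :=
  hA.isPositive.re_inner_nonneg_right x

end Diagonalization

/-! ### Traces and entropy in an eigenbasis -/

section Eigenbasis

variable {H : Type*} [NormedAddCommGroup H] [InnerProductSpace ℂ H] [CompleteSpace H]
  {ι κ : Type*}

theorem re_inner_eigenvector {A : H →L[ℂ] H} {b : HilbertBasis ι ℂ H} {p : ι → ℝ}
    (hb : ∀ i, A (b i) = (p i : ℂ) • b i) (i : ι) : (⟪b i, A (b i)⟫_ℂ).re = p i := by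
  rw [hb, inner_smul_right, inner_self_eq_norm_sq_to_K, b.orthonormal.1 i]
  simp

namespace IsEigenbasis

variable {A : H →L[ℂ] H} {b : HilbertBasis ι ℂ H} {p : ι → ℝ}

theorem ofReal_re_inner (hA : A.IsPositive) (hb : IsEigenbasis A b p) (x : H) :
    ENNReal.ofReal (⟪x, A x⟫_ℂ).re = ∑' i, ENNReal.ofReal (p i * ‖⟪b i, x⟫_ℂ‖ ^ 2) := by
  have h := (b.hasSum_inner_mul_inner x (A x)).mapL Complex.reCLM
  have h2 : ∀ i, Complex.reCLM (⟪x, b i⟫_ℂ * ⟪b i, A x⟫_ℂ) = p i * ‖⟪b i, x⟫_ℂ‖ ^ 2 := by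
    intro i
    have h3 : ⟪b i, A x⟫_ℂ = p i * ⟪b i, x⟫_ℂ := by
      have h4 := hA.isSymmetric (b i) x
      simp only [ContinuousLinearMap.coe_coe] at h4
      rw [← h4, hb.apply_eq, inner_smul_left, Complex.conj_ofReal]
    rw [h3, ← inner_conj_symm x (b i), mul_left_comm, mul_comm _ (⟪b i, x⟫_ℂ), Complex.mul_conj,
      Complex.normSq_eq_norm_sq]
    simp [← Complex.ofReal_mul, -Complex.ofReal_pow]
  simp only [h2] at h
  have h5 : ∀ i, 0 ≤ p i * ‖⟪b i, x⟫_ℂ‖ ^ 2 := fun i => mul_nonneg (hb.nonneg i) (sq_nonneg _)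
  rw [← ENNReal.ofReal_tsum_of_nonneg h5 h.summable, h.tsum_eq]
  rfl

theorem trace_eq_tsum (hA : A.IsPositive) (hb : IsEigenbasis A b p) :
    trace A = ∑' i, ENNReal.ofReal (p i) := by
  rw [trace_eq hA b]
  simp only [re_inner_eigenvector hb.apply_eq]

theorem le_one (hA : A.IsPositive) (hb : IsEigenbasis A b p) (ht : trace A ≤ 1) (i : ι) :
    p i ≤ 1 := by
  rw [hb.trace_eq_tsum hA] at ht
  exact ENNReal.ofReal_le_one.1 ((ENNReal.le_tsum i).trans ht)

/-- Trace at most one puts the spectrum in `[0, 1]`, where `-x log₂ x ≥ 0`; the trace of the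
resulting positive operator may then be computed in the eigenbasis. -/
theorem entropy_eq_tsum (hA : A.IsPositive) (hb : IsEigenbasis A b p) (ht : trace A ≤ 1) :
    entropy A = ENNReal.ofReal (Real.log 2)⁻¹ * ∑' i, ENNReal.ofReal (Real.negMulLog (p i)) := by
  have h0 : 0 ≤ A := by rwa [ContinuousLinearMap.nonneg_iff_isPositive]
  have hn : ‖A‖ ≤ 1 := by
    have h := (enorm_le_trace hA).trans ht
    rwa [← ofReal_norm, ENNReal.ofReal_le_one] at h
  have hpos : (cfc (fun x : ℝ => -(x * Real.logb 2 x)) A).IsPositive := by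
    rw [← ContinuousLinearMap.nonneg_iff_isPositive]
    refine cfc_nonneg fun x hx => ?_
    have hx0 : 0 ≤ x := spectrum_nonneg_of_nonneg h0 hx
    have hx1 : x ≤ 1 := (le_abs_self x).trans ((spectrum.norm_le_norm_mul_of_mem hx).trans
      (mul_le_one₀ hn (norm_nonneg _) ContinuousLinearMap.norm_id_le))
    have := Real.logb_nonpos one_lt_two hx0 hx1
    nlinarith
  have hlog : 0 ≤ (Real.log 2)⁻¹ := inv_nonneg.2 (Real.log_nonneg one_le_two)
  have hA' : IsSelfAdjoint A := hA.isSelfAdjoint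
  rw [entropy, trace_eq hpos b, ← ENNReal.tsum_mul_left]
  refine tsum_congr fun i => ?_
  rw [re_inner_eigenvector (p := fun i => -(p i * Real.logb 2 (p i))) fun i =>
    cfc_apply_eigenvector hA' continuous_neg_mul_logb (hb.apply_eq i), ← ENNReal.ofReal_mul hlog]
  congr 1
  simp only [Real.logb, Real.negMulLog]
  ring

theorem trace_adjoint_conj (hA : A.IsPositive) (hb : IsEigenbasis A b p)
    (d : HilbertBasis κ ℂ H) (X : H →L[ℂ] H) :
    trace (X.adjoint ∘L A ∘L X) =
      ∑' q : κ × ι, ENNReal.ofReal (p q.2 * ‖⟪b q.2, X (d q.1)⟫_ℂ‖ ^ 2) := by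
  rw [trace_eq (hA.adjoint_conj X) d, ENNReal.tsum_prod']
  refine tsum_congr fun j => ?_
  rw [← hb.ofReal_re_inner hA (X (d j))]
  simp [ContinuousLinearMap.adjoint_inner_right]

theorem trace_conj_adjoint (hA : A.IsPositive) (hb : IsEigenbasis A b p)
    (d : HilbertBasis κ ℂ H) (X : H →L[ℂ] H) :
    trace (X ∘L A ∘L X.adjoint) =
      ∑' q : ι × κ, ENNReal.ofReal (p q.1 * ‖⟪d q.2, X (b q.1)⟫_ℂ‖ ^ 2) := by
  have h := hb.trace_adjoint_conj hA d X.adjoint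
  rw [ContinuousLinearMap.adjoint_adjoint] at h
  rw [h, ← (Equiv.prodComm ι κ).tsum_eq]
  refine tsum_congr fun q => ?_
  rw [Equiv.prodComm_apply, Prod.fst_swap, Prod.snd_swap, ContinuousLinearMap.adjoint_inner_right,
    ← inner_conj_symm, RCLike.norm_conj]

end IsEigenbasis

theorem tsum_norm_inner_sq (b : HilbertBasis ι ℂ H) {x : H} (hx : ‖x‖ = 1) :
    ∑' i, ENNReal.ofReal (‖⟪b i, x⟫_ℂ‖ ^ 2) = 1 := by
  rw [← hasSum_norm_sq, hx]; simp

theorem tsum_norm_inner_sq' (b : HilbertBasis ι ℂ H) {x : H} (hx : ‖x‖ = 1) :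
    ∑' i, ENNReal.ofReal (‖⟪x, b i⟫_ℂ‖ ^ 2) = 1 := by
  rw [← tsum_norm_inner_sq b hx]
  refine tsum_congr fun i => ?_
  rw [← inner_conj_symm, RCLike.norm_conj]

end Eigenbasis

/-! ### Operators `1 ⊗ X` and the partial trace -/

section Amplification

variable {C B : Type*} [NormedAddCommGroup C] [InnerProductSpace ℂ C] [CompleteSpace C]
  [NormedAddCommGroup B] [InnerProductSpace ℂ B] [CompleteSpace B]

/-- `X'` acts as `1 ⊗ X`, and its adjoint as `1 ⊗ X†`. -/
structure IsAmplification (X : B →L[ℂ] B) (X' : HilbertTensor C B →L[ℂ] HilbertTensor C B) :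
    Prop where
  apply_tensor : ∀ c y, X' (tensorLeft c y) = tensorLeft c (X y)
  adjoint_apply_tensor : ∀ c y, X'.adjoint (tensorLeft c y) = tensorLeft c (X.adjoint y)

namespace IsAmplification

variable {X Y : B →L[ℂ] B} {X' Y' : HilbertTensor C B →L[ℂ] HilbertTensor C B}

theorem adjoint (h : IsAmplification X X') : IsAmplification X.adjoint X'.adjoint :=
  ⟨h.2, by simpa only [ContinuousLinearMap.adjoint_adjoint] using h.1⟩

theorem one : IsAmplification (1 : B →L[ℂ] B) (1 : HilbertTensor C B →L[ℂ] HilbertTensor C B) :=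
  ⟨fun _ _ => rfl, fun c y => by
    simp only [← ContinuousLinearMap.star_eq_adjoint, star_one]; rfl⟩

theorem sub (h : IsAmplification X X') (h' : IsAmplification Y Y') :
    IsAmplification (X - Y) (X' - Y') :=
  ⟨fun c y => by simp [h.1, h'.1], fun c y => by simp [h.2, h'.2]⟩

theorem add (h : IsAmplification X X') (h' : IsAmplification Y Y') :
    IsAmplification (X + Y) (X' + Y') :=
  ⟨fun c y => by simp [h.1, h'.1], fun c y => by simp [h.2, h'.2]⟩

theorem smul (a : ℂ) (h : IsAmplification X X') : IsAmplification (a • X) (a • X') :=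
  by
  refine ⟨fun c y => by simp [h.1], fun c y => ?_⟩
  have := h.2 c y
  simp only [← ContinuousLinearMap.star_eq_adjoint, star_smul, smul_apply, map_smul] at this ⊢
  rw [this]

theorem adjoint_tensorRight_apply (z y : B) (c : C) :
    (tensorRight z).adjoint (tensorLeft c y) = ⟪z, y⟫_ℂ • c := by
  refine ext_inner_left ℂ fun v => ?_
  rw [ContinuousLinearMap.adjoint_inner_right, tensorRight_apply, inner_tensorLeft,
    inner_smul_right, mul_comm]

/-- `1 ⊗ |y⟩⟨z|` factors through `C`: contract with `z`, then tensor with `y`. -/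
theorem rankOne (y z : B) : IsAmplification (InnerProductSpace.rankOne ℂ y z)
    (tensorRight y ∘L (tensorRight z).adjoint :
      HilbertTensor C B →L[ℂ] HilbertTensor C B) := by
  have key : ∀ (y z : B) (c : C) (v : B), tensorRight y ((tensorRight z).adjoint (tensorLeft c v)) =
      tensorLeft c (⟪z, v⟫_ℂ • y) := by
    intro y z c v
    rw [adjoint_tensorRight_apply, map_smul, map_smul, tensorRight_apply]
  refine ⟨fun c v => ?_, fun c v => ?_⟩
  · exact key y z c v
  · rw [ContinuousLinearMap.adjoint_comp, ContinuousLinearMap.adjoint_adjoint,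
      InnerProductSpace.adjoint_rankOne]
    exact key z y c v

/-- In a product basis the adjoint of `X'` moves only the `B` factor, to `X† b_j`; summing over the
basis of `C` then produces the partial trace. -/
theorem trace_conj_adjoint (h : IsAmplification X X')
    {ρ : HilbertTensor C B →L[ℂ] HilbertTensor C B} (hρ : IsState ρ) :
    trace (X' ∘L ρ ∘L X'.adjoint) = trace (X ∘L partialTrace ρ ∘L X.adjoint) := by
  obtain ⟨e, he⟩ := exists_productBasis (stdBasis C) (stdBasis B)
  rw [trace_eq (hρ.isPositive.conj_adjoint X') e, ENNReal.tsum_prod', ENNReal.tsum_comm,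
    trace_eq (hρ.partialTrace.isPositive.conj_adjoint X) (stdBasis B)]
  refine tsum_congr fun j => ?_
  set v := X.adjoint (stdBasis B j)
  have hre : HasSum (fun i => (⟪v, compress ρ (stdBasis C i) v⟫_ℂ).re)
      (⟪v, partialTrace ρ v⟫_ℂ).re :=
    (hasSum_inner_compress (hasSum_partialTrace hρ.isPositive hρ.trace_ne_top (stdBasis C))
      v v).mapL Complex.reCLM
  have hnn : ∀ i, 0 ≤ (⟪v, compress ρ (stdBasis C i) v⟫_ℂ).re := fun i =>
    (isPositive_compress hρ.isPositive _).re_inner_nonneg_right _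
  have h1 : ⟪stdBasis B j, (X ∘L partialTrace ρ ∘L X.adjoint) (stdBasis B j)⟫_ℂ =
      ⟪v, partialTrace ρ v⟫_ℂ := by
    simp [v, ContinuousLinearMap.adjoint_inner_left]
  rw [h1, ← hre.tsum_eq, ENNReal.ofReal_tsum_of_nonneg hnn hre.summable]
  refine tsum_congr fun i => ?_
  rw [inner_compress, ← h.2, ContinuousLinearMap.adjoint_inner_left, he]
  rfl

theorem trace_adjoint_conj (h : IsAmplification X X')
    {ρ : HilbertTensor C B →L[ℂ] HilbertTensor C B} (hρ : IsState ρ) :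
    trace (X'.adjoint ∘L ρ ∘L X') = trace (X.adjoint ∘L partialTrace ρ ∘L X) := by
  simpa only [ContinuousLinearMap.adjoint_adjoint] using h.adjoint.trace_conj_adjoint hρ

end IsAmplification

end Amplification

/-! ### Scalar inequalities and the integral over `s` -/

section Scalar

/-- The variational principle for a single matrix entry. After clearing the denominator, the defect
for `u = x + y` is the square `s⁻¹ (p x - s q y) ^ 2`. -/
theorem mul_div_add_le {p q s u x y : ℝ} (hp : 0 ≤ p) (hq : 0 ≤ q) (hs : 0 < s) (hu : 0 ≤ u)
    (h : u ≤ x + y) : u ^ 2 * (p * q / (p + s * q)) ≤ s⁻¹ * (p * x ^ 2) + q * y ^ 2 := by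
  rcases (add_nonneg hp (mul_nonneg hs.le hq)).eq_or_lt with h0 | h0
  · rw [← h0, div_zero, mul_zero]
    positivity
  have h1 : u ^ 2 ≤ (x + y) ^ 2 := by gcongr
  calc u ^ 2 * (p * q / (p + s * q)) ≤ (x + y) ^ 2 * (p * q / (p + s * q)) := by gcongr
    _ ≤ s⁻¹ * (p * x ^ 2) + q * y ^ 2 := by
      rw [mul_div_assoc', div_le_iff₀ h0, ← sub_nonneg]
      have : (s⁻¹ * (p * x ^ 2) + q * y ^ 2) * (p + s * q) - (x + y) ^ 2 * (p * q) =
          s⁻¹ * (p * x - s * q * y) ^ 2 := by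
        field_simp
        ring
      rw [this]
      positivity

/-- The minimiser in `mul_div_add_le`, obtained by solving `p x = s q y` with `x + y = u`. -/
theorem mul_div_add_eq {p q s : ℝ} (hp : 0 ≤ p) (hq : 0 ≤ q) (hs : 0 < s) (u : ℂ) :
    s⁻¹ * (p * ‖((s * q / (p + s * q) : ℝ) : ℂ) * u‖ ^ 2) +
      q * ‖u - ((s * q / (p + s * q) : ℝ) : ℂ) * u‖ ^ 2 = ‖u‖ ^ 2 * (p * q / (p + s * q)) := by
  rcases (add_nonneg hp (mul_nonneg hs.le hq)).eq_or_lt with h0 | h0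
  · have h1 : p = 0 := by nlinarith [mul_nonneg hs.le hq]
    have h2 : q = 0 := by
      have : s * q = 0 := by linarith
      exact (mul_eq_zero.1 this).resolve_left hs.ne'
    simp [h1, h2]
  · have h3 : u - ((s * q / (p + s * q) : ℝ) : ℂ) * u = ((p / (p + s * q) : ℝ) : ℂ) * u := by
      have : p / (p + s * q) = 1 - s * q / (p + s * q) := by field_simp; ring
      rw [this]
      push_cast
      ring
    rw [h3, norm_mul, norm_mul, Complex.norm_real, Complex.norm_real, mul_pow, mul_pow,
      Real.norm_eq_abs, Real.norm_eq_abs, sq_abs, sq_abs]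
    field_simp
    ring

theorem lintegral_mul_div_add {p q w T : ℝ} (hp : 0 ≤ p) (hq : 0 ≤ q) (hw : 0 ≤ w) (hT : 0 ≤ T) :
    ∫⁻ s in Set.Ioc 0 T, ENNReal.ofReal (w * (p * q / (p + s * q))) =
      ENNReal.ofReal (w * (p * (Real.log (p + T * q) - Real.log p))) := by
  rcases hp.eq_or_lt with rfl | hp
  · simp
  have hpos : ∀ s ∈ Set.uIcc 0 T, 0 < p + s * q := fun s hs => by
    rw [Set.uIcc_of_le hT] at hs
    have := mul_nonneg hs.1 hq
    linarith
  have hcont : ContinuousOn (fun s : ℝ => w * (p * q / (p + s * q))) (Set.uIcc 0 T) :=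
    continuousOn_const.mul (continuousOn_const.div (by fun_prop) fun s hs => (hpos s hs).ne')
  have hint := hcont.intervalIntegrable (μ := MeasureTheory.volume)
  have h1 := intervalIntegral.integral_eq_sub_of_hasDerivAt
    (f := fun s => w * (p * Real.log (p + s * q))) (fun s hs => by
      have h2 : HasDerivAt (fun s : ℝ => p + s * q) q s := by
        simpa using ((hasDerivAt_id s).mul_const q).const_add p
      have h3 := ((h2.log (hpos s hs).ne').const_mul p).const_mul w
      rwa [mul_div_assoc'] at h3) hint
  rw [← MeasureTheory.ofReal_integral_eq_lintegral_ofReal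
      ((intervalIntegrable_iff_integrableOn_Ioc_of_le hT).1 hint),
    ← intervalIntegral.integral_of_le hT, h1]
  · congr 1
    simp only [zero_mul, add_zero]
    ring
  · filter_upwards [MeasureTheory.ae_restrict_mem measurableSet_Ioc] with s hs
    have := hpos s (by rw [Set.uIcc_of_le hT]; exact ⟨hs.1.le, hs.2⟩)
    change 0 ≤ w * (p * q / (p + s * q))
    positivity

end Scalar

/-! ### Variational principle and monotonicity -/

section Monotonicity

variable {H K : Type*} [NormedAddCommGroup H] [InnerProductSpace ℂ H] [CompleteSpace H]
  [NormedAddCommGroup K] [InnerProductSpace ℂ K] [CompleteSpace K]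
  {ι κ ι' κ' : Type*}

/-- The operators of finite rank, as the span of the operators `x ↦ ⟪z, x⟫ y`. -/
def finiteRank (H : Type*) [NormedAddCommGroup H] [InnerProductSpace ℂ H] :
    Submodule ℂ (H →L[ℂ] H) :=
  Submodule.span ℂ {T | ∃ y z, T = InnerProductSpace.rankOne ℂ y z}

/-- The squared moduli of the entries of the transition matrix between two orthonormal bases. -/
def overlap (b : HilbertBasis ι ℂ H) (d : HilbertBasis κ ℂ H) (x : ι × κ) : ℝ :=
  ‖⟪d x.2, b x.1⟫_ℂ‖ ^ 2

theorem overlap_nonneg (b : HilbertBasis ι ℂ H) (d : HilbertBasis κ ℂ H) (x : ι × κ) :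
    0 ≤ overlap b d x := sq_nonneg _

theorem tsum_ofReal_overlap_mul_fst (b : HilbertBasis ι ℂ H) (d : HilbertBasis κ ℂ H)
    (f : ι → ℝ) : ∑' x, ENNReal.ofReal (overlap b d x * f x.1) = ∑' i, ENNReal.ofReal (f i) := by
  rw [ENNReal.tsum_prod']
  refine tsum_congr fun i => ?_
  simp only [overlap, ENNReal.ofReal_mul (sq_nonneg _)]
  rw [ENNReal.tsum_mul_right, tsum_norm_inner_sq d (b.orthonormal.1 i), one_mul]

theorem tsum_ofReal_overlap_mul_snd (b : HilbertBasis ι ℂ H) (d : HilbertBasis κ ℂ H)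
    (f : κ → ℝ) : ∑' x, ENNReal.ofReal (overlap b d x * f x.2) = ∑' j, ENNReal.ofReal (f j) := by
  rw [ENNReal.tsum_prod', ENNReal.tsum_comm]
  refine tsum_congr fun i => ?_
  simp only [overlap, ENNReal.ofReal_mul (sq_nonneg _)]
  rw [ENNReal.tsum_mul_right, tsum_norm_inner_sq' b (d.orthonormal.1 i), one_mul]

variable {A D : H →L[ℂ] H} {b : HilbertBasis ι ℂ H} {d : HilbertBasis κ ℂ H}
  {p : ι → ℝ} {q : κ → ℝ}

/-- Entrywise `mul_div_add_le`, applied to the splitting `⟪d j, b i⟫ = ⟪d j, X (b i)⟫ + ⟪d j, (1 -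
X) (b i)⟫`. -/
theorem tsum_le_trace_add_trace (hA : A.IsPositive) (hD : D.IsPositive)
    (hb : IsEigenbasis A b p) (hd : IsEigenbasis D d q) {s : ℝ} (hs : 0 < s) (X : H →L[ℂ] H) :
    ∑' x, ENNReal.ofReal (overlap b d x * (p x.1 * q x.2 / (p x.1 + s * q x.2))) ≤
      ENNReal.ofReal s⁻¹ * trace (X ∘L A ∘L X.adjoint) +
        trace ((1 - X).adjoint ∘L D ∘L (1 - X)) := by
  rw [hb.trace_conj_adjoint hA d, hd.trace_adjoint_conj hD b, ← ENNReal.tsum_mul_left,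
    ← ENNReal.tsum_add]
  refine ENNReal.tsum_le_tsum fun x => ?_
  have hp := hb.nonneg x.1
  have hq := hd.nonneg x.2
  rw [← ENNReal.ofReal_mul (by positivity), ← ENNReal.ofReal_add (by positivity) (by positivity)]
  refine ENNReal.ofReal_le_ofReal (mul_div_add_le hp hq hs (norm_nonneg _) ?_)
  refine le_trans (le_of_eq ?_) (norm_add_le _ _)
  rw [← inner_add_right]
  simp

open scoped Classical in
theorem exists_finiteRank_inner_eq (b : HilbertBasis ι ℂ H) (d : HilbertBasis κ ℂ H)
    (F : Finset (ι × κ)) (a : ι × κ → ℂ) :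
    ∃ X ∈ finiteRank H, ∀ x : ι × κ, ⟪d x.2, X (b x.1)⟫_ℂ = if x ∈ F then a x else 0 := by
  refine ⟨∑ x ∈ F, a x • InnerProductSpace.rankOne ℂ (d x.2) (b x.1),
    Submodule.sum_mem _ fun x _ => Submodule.smul_mem _ _
      (Submodule.subset_span ⟨_, _, rfl⟩), fun x => ?_⟩
  have hbo := orthonormal_iff_ite.1 b.orthonormal
  have hdo := orthonormal_iff_ite.1 d.orthonormal
  have h1 : ∀ y : ι × κ, ⟪d x.2, (a y • InnerProductSpace.rankOne ℂ (d y.2) (b y.1)) (b x.1)⟫_ℂ =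
      if x = y then a y else 0 := by
    intro y
    simp only [smul_apply, InnerProductSpace.rankOne_apply, inner_smul_right, hbo, hdo]
    by_cases h : x = y
    · simp [h]
    · rw [if_neg h]
      by_cases h2 : y.1 = x.1
      · have h3 : x.2 ≠ y.2 := fun h3 => h (Prod.ext h2.symm h3)
        simp [h3]
      · simp [h2]
  simp only [sum_apply, inner_sum, h1, Finset.sum_ite_eq]

theorem tsum_le_sum_add_tsum {α : Type*} (F : Finset α) {f g h : α → ENNReal}
    (hg : ∀ x ∈ F, f x ≤ g x) (hh : ∀ x ∉ F, f x ≤ h x) :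
    ∑' x, f x ≤ ∑ x ∈ F, g x + ∑' x : {x // x ∉ F}, h x := by
  rw [← ENNReal.sum_add_tsum_compl F f]
  exact add_le_add (Finset.sum_le_sum hg) (ENNReal.tsum_le_tsum fun x => hh x fun hx => x.2 hx)

/-- `X` has the optimal entries on `F` and zero entries elsewhere. Outside `F` only the second trace
contributes, and its tail does not depend on `s`. -/
theorem exists_trace_add_trace_le (hA : A.IsPositive) (hD : D.IsPositive)
    (hb : IsEigenbasis A b p) (hd : IsEigenbasis D d q) {s : ℝ} (hs : 0 < s)
    (F : Finset (ι × κ)) : ∃ X ∈ finiteRank H,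
      ENNReal.ofReal s⁻¹ * trace (X ∘L A ∘L X.adjoint) +
        trace ((1 - X).adjoint ∘L D ∘L (1 - X)) ≤
      ∑ x ∈ F, ENNReal.ofReal (overlap b d x * (p x.1 * q x.2 / (p x.1 + s * q x.2))) +
        ∑' x : {x // x ∉ F}, ENNReal.ofReal (overlap b d x * q x.1.2) := by
  classical
  obtain ⟨X, hmem, hX⟩ := exists_finiteRank_inner_eq b d F fun x =>
    ((s * q x.2 / (p x.1 + s * q x.2) : ℝ) : ℂ) * ⟪d x.2, b x.1⟫_ℂ
  have hsub : ∀ x : ι × κ, ⟪d x.2, (1 - X) (b x.1)⟫_ℂ =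
      ⟪d x.2, b x.1⟫_ℂ - ⟪d x.2, X (b x.1)⟫_ℂ := fun x => by
    rw [← inner_sub_right]; rfl
  refine ⟨X, hmem, ?_⟩
  rw [hb.trace_conj_adjoint hA d, hd.trace_adjoint_conj hD b, ← ENNReal.tsum_mul_left,
    ← ENNReal.tsum_add]
  refine tsum_le_sum_add_tsum F (h := fun x => ENNReal.ofReal (overlap b d x * q x.2))
    (fun x hx => ?_) (fun x hx => ?_)
  · have hp := hb.nonneg x.1
    have hq := hd.nonneg x.2
    rw [← ENNReal.ofReal_mul (by positivity), ← ENNReal.ofReal_add (by positivity) (by positivity),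
      hsub, hX, if_pos hx, overlap, mul_div_add_eq hp hq hs]
  · rw [hsub, hX, if_neg hx, overlap]
    simp [mul_comm]

/-- The pair `(A, D)` is at least as distinguishable as the pair `(A', D')`, in a quadratic
sense. -/
def Dominates (A D : H →L[ℂ] H) (A' D' : K →L[ℂ] K) : Prop :=
  ∀ X ∈ finiteRank K, ∃ Y : H →L[ℂ] H,
    trace (Y ∘L A ∘L Y.adjoint) ≤ trace (X ∘L A' ∘L X.adjoint) ∧
    trace ((1 - Y).adjoint ∘L D ∘L (1 - Y)) ≤ trace ((1 - X).adjoint ∘L D' ∘L (1 - X))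

variable {A' D' : K →L[ℂ] K} {b' : HilbertBasis ι' ℂ K} {d' : HilbertBasis κ' ℂ K}
  {p' : ι' → ℝ} {q' : κ' → ℝ}

theorem Dominates.tsum_le (h : Dominates A D A' D') (hA : A.IsPositive) (hD : D.IsPositive)
    (hA' : A'.IsPositive) (hD' : D'.IsPositive) (ht : trace D' ≠ ⊤)
    (hb : IsEigenbasis A b p) (hd : IsEigenbasis D d q)
    (hb' : IsEigenbasis A' b' p') (hd' : IsEigenbasis D' d' q') {T : ℝ} (hT : 0 ≤ T) :
    ∑' x, ENNReal.ofReal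
        (overlap b d x * (p x.1 * (Real.log (p x.1 + T * q x.2) - Real.log (p x.1)))) ≤
      ∑' x, ENNReal.ofReal
        (overlap b' d' x * (p' x.1 * (Real.log (p' x.1 + T * q' x.2) - Real.log (p' x.1)))) := by
  -- The index sets may be uncountable, so the integral is exchanged with finite sums only, over `E`
  -- on the left and `F` on the right. The tail outside `F` contributes at most a constant times `T`
  -- and vanishes in the limit because `D'` has finite trace.
  rw [ENNReal.tsum_eq_iSup_sum]
  refine iSup_le fun E => ?_
  have key : ∀ F : Finset (ι' × κ'),
      ∑ x ∈ E, ENNReal.ofReal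
        (overlap b d x * (p x.1 * (Real.log (p x.1 + T * q x.2) - Real.log (p x.1)))) ≤
      ∑' x, ENNReal.ofReal
        (overlap b' d' x * (p' x.1 * (Real.log (p' x.1 + T * q' x.2) - Real.log (p' x.1)))) +
      (∑' x : {x // x ∉ F}, ENNReal.ofReal (overlap b' d' x * q' x.1.2)) * ENNReal.ofReal T := by
    intro F
    refine le_trans ?_ (add_le_add (ENNReal.sum_le_tsum F) le_rfl)
    simp only [← lintegral_mul_div_add (hb.nonneg _) (hd.nonneg _) (overlap_nonneg b d _) hT,
      ← lintegral_mul_div_add (hb'.nonneg _) (hd'.nonneg _) (overlap_nonneg b' d' _) hT]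
    rw [← MeasureTheory.lintegral_finsetSum _ fun x _ => by fun_prop,
      ← MeasureTheory.lintegral_finsetSum _ fun x _ => by fun_prop]
    have hc : (∑' x : {x // x ∉ F}, ENNReal.ofReal (overlap b' d' x * q' x.1.2)) *
        ENNReal.ofReal T = ∫⁻ _ in Set.Ioc 0 T,
          ∑' x : {x // x ∉ F}, ENNReal.ofReal (overlap b' d' x * q' x.1.2) := by
      rw [MeasureTheory.setLIntegral_const, Real.volume_Ioc, sub_zero]
    rw [hc, ← MeasureTheory.lintegral_add_right _ measurable_const]
    refine MeasureTheory.setLIntegral_mono' measurableSet_Ioc fun s hs => ?_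
    obtain ⟨X, hX, hle⟩ := exists_trace_add_trace_le hA' hD' hb' hd' hs.1 F
    obtain ⟨Y, hY1, hY2⟩ := h X hX
    refine (ENNReal.sum_le_tsum E).trans
      ((tsum_le_trace_add_trace hA hD hb hd hs.1 Y).trans (le_trans ?_ hle))
    gcongr
  have htail : Filter.Tendsto (fun F : Finset (ι' × κ') =>
      ∑' x : {x // x ∉ F}, ENNReal.ofReal (overlap b' d' x * q' x.1.2)) Filter.atTop (nhds 0) :=
    ENNReal.tendsto_tsum_compl_atTop_zero (f := fun x => ENNReal.ofReal (overlap b' d' x * q' x.2))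
      (by rwa [tsum_ofReal_overlap_mul_snd, ← hd'.trace_eq_tsum hD'])
  have hlim := (ENNReal.Tendsto.mul_const (b := ENNReal.ofReal T) htail
    (Or.inr ENNReal.ofReal_ne_top)).const_add (∑' x, ENNReal.ofReal
        (overlap b' d' x * (p' x.1 * (Real.log (p' x.1 + T * q' x.2) - Real.log (p' x.1)))))
  rw [zero_mul, add_zero] at hlim
  exact ge_of_tendsto' hlim key

end Monotonicity

/-! ### Monotonicity of relative entropy in additive form -/

section CrossEntropy

variable {H K : Type*} [NormedAddCommGroup H] [InnerProductSpace ℂ H] [CompleteSpace H]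
  [NormedAddCommGroup K] [InnerProductSpace ℂ K] [CompleteSpace K]
  {ι κ ι' κ' : Type*}

variable {A D : H →L[ℂ] H} {b : HilbertBasis ι ℂ H} {d : HilbertBasis κ ℂ H}
  {p : ι → ℝ} {q : κ → ℝ}

/-- Since `p, q ≤ 1`, also `log (T + 1) - log (p + T q) ≥ 0`. This complement trades the integrated
quantity for the entropy without subtraction in `[0, ∞]`. -/
theorem tsum_add_tsum_log (hb : IsEigenbasis A b p) (hA : IsState A)
    (hq0 : ∀ j, 0 ≤ q j) (hq1 : ∀ j, q j ≤ 1) {T : ℝ} (hT : 0 ≤ T) :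
    ∑' x, ENNReal.ofReal
        (overlap b d x * (p x.1 * (Real.log (p x.1 + T * q x.2) - Real.log (p x.1)))) +
      ∑' x, ENNReal.ofReal
        (overlap b d x * (p x.1 * (Real.log (T + 1) - Real.log (p x.1 + T * q x.2)))) =
      ENNReal.ofReal (Real.log (T + 1)) + ∑' i, ENNReal.ofReal (Real.negMulLog (p i)) := by
  have hp1 := hb.le_one hA.isPositive hA.trace_eq_one.le
  have hlog : 0 ≤ Real.log (T + 1) := Real.log_nonneg (by linarith)
  have h1 : ∑' i, ENNReal.ofReal (p i * Real.log (T + 1)) = ENNReal.ofReal (Real.log (T + 1)) := by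
    simp only [ENNReal.ofReal_mul (hb.nonneg _)]
    rw [ENNReal.tsum_mul_right, ← hb.trace_eq_tsum hA.isPositive, hA.trace_eq_one, one_mul]
  rw [← ENNReal.tsum_add, ← h1, ← ENNReal.tsum_add]
  have h2 : ∀ i, ENNReal.ofReal (p i * Real.log (T + 1)) + ENNReal.ofReal (Real.negMulLog (p i)) =
      ENNReal.ofReal (p i * Real.log (T + 1) + Real.negMulLog (p i)) := fun i =>
    (ENNReal.ofReal_add (mul_nonneg (hb.nonneg i) hlog)
      (Real.negMulLog_nonneg (hb.nonneg i) (hp1 i))).symm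
  simp only [h2]
  rw [← tsum_ofReal_overlap_mul_fst b d]
  refine tsum_congr fun x => ?_
  rcases (hb.nonneg x.1).eq_or_lt with h0 | h0
  · simp [← h0]
  have hTq := mul_nonneg hT (hq0 x.2)
  have hTq' := mul_le_mul_of_nonneg_left (hq1 x.2) hT
  have hp' := hp1 x.1
  rw [← ENNReal.ofReal_add]
  · rw [Real.negMulLog]
    congr 1
    ring
  · refine mul_nonneg (overlap_nonneg _ _ _) (mul_nonneg h0.le (sub_nonneg.2 ?_))
    exact Real.log_le_log h0 (by linarith)
  · refine mul_nonneg (overlap_nonneg _ _ _) (mul_nonneg h0.le (sub_nonneg.2 ?_))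
    exact Real.log_le_log (by linarith) (by linarith)

/-- The cross entropy `- Tr A log₂ D`, for `D` with eigenbasis `d` and eigenvalues `q`. -/
def crossEntropy (A : H →L[ℂ] H) (d : HilbertBasis κ ℂ H) (q : κ → ℝ) : ENNReal :=
  ENNReal.ofReal (Real.log 2)⁻¹ *
    ∑' j, ENNReal.ofReal (-Real.log (q j) * (⟪d j, A (d j)⟫_ℂ).re)

theorem crossEntropy_eq_tsum_overlap (hA : A.IsPositive) (hb : IsEigenbasis A b p)
    (d : HilbertBasis κ ℂ H) (hq0 : ∀ j, 0 ≤ q j) (hq1 : ∀ j, q j ≤ 1) :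
    crossEntropy A d q = ENNReal.ofReal (Real.log 2)⁻¹ *
      ∑' x, ENNReal.ofReal (overlap b d x * (p x.1 * -Real.log (q x.2))) := by
  rw [crossEntropy, ENNReal.tsum_prod', ENNReal.tsum_comm]
  congr 1
  refine tsum_congr fun j => ?_
  have hlog : 0 ≤ -Real.log (q j) := neg_nonneg.2 (Real.log_nonpos (hq0 j) (hq1 j))
  rw [ENNReal.ofReal_mul hlog, hb.ofReal_re_inner hA, ← ENNReal.tsum_mul_left]
  refine tsum_congr fun i => ?_
  rw [← ENNReal.ofReal_mul hlog, overlap, ← inner_conj_symm (d j), RCLike.norm_conj]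
  congr 1
  ring

/-- `l A ≤ D` forces `A` to vanish on the kernel of `D`. This makes the convention `Real.log 0 = 0`
harmless: the terms with `q = 0` have weight zero. -/
theorem IsEigenbasis.mul_overlap_eq_zero (hA : A.IsPositive) (hb : IsEigenbasis A b p)
    (hd : IsEigenbasis D d q) {l : ℝ} (hl : 0 < l)
    (hle : ∀ x, l * (⟪x, A x⟫_ℂ).re ≤ (⟪x, D x⟫_ℂ).re) (x : ι × κ) (hx : q x.2 = 0) :
    overlap b d x * p x.1 = 0 := by
  have h1 := hle (d x.2)
  rw [re_inner_eigenvector hd.apply_eq, hx] at h1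
  have h2 : (⟪d x.2, A (d x.2)⟫_ℂ).re ≤ 0 := by nlinarith
  have h3 := hb.ofReal_re_inner hA (d x.2)
  rw [ENNReal.ofReal_of_nonpos h2] at h3
  have h4 := ENNReal.ofReal_eq_zero.1 (ENNReal.tsum_eq_zero.1 h3.symm x.1)
  have h5 := mul_nonneg (hb.nonneg x.1) (sq_nonneg ‖⟪b x.1, d x.2⟫_ℂ‖)
  rw [overlap, ← inner_conj_symm, RCLike.norm_conj, mul_comm]
  exact le_antisymm h4 h5

variable {A' D' : K →L[ℂ] K} {b' : HilbertBasis ι' ℂ K} {d' : HilbertBasis κ' ℂ K}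
  {p' : ι' → ℝ} {q' : κ' → ℝ}

theorem Dominates.tsum_negMulLog_add_le (h : Dominates A D A' D') (hA : IsState A)
    (hD : D.IsPositive) (hA' : IsState A') (hD' : D'.IsPositive)
    (ht : trace D ≤ 1) (ht' : trace D' ≤ 1)
    (hb : IsEigenbasis A b p) (hd : IsEigenbasis D d q)
    (hb' : IsEigenbasis A' b' p') (hd' : IsEigenbasis D' d' q') {T : ℝ} (hT : 0 < T)
    (h0 : ∀ x : ι × κ, q x.2 = 0 → overlap b d x * p x.1 = 0) :
    ∑' i, ENNReal.ofReal (Real.negMulLog (p i)) + ∑' x, ENNReal.ofReal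
        (overlap b' d' x * (p' x.1 * (Real.log (T + 1) - Real.log (p' x.1 + T * q' x.2)))) ≤
      ∑' i, ENNReal.ofReal (Real.negMulLog (p' i)) +
        (∑' x, ENNReal.ofReal (overlap b d x * (p x.1 * -Real.log (q x.2))) +
          ENNReal.ofReal (Real.log (T + 1) - Real.log T)) := by
  have hq1 := hd.le_one hD ht
  have hG := h.tsum_le hA.isPositive hD hA'.isPositive hD'
    (ht'.trans_lt ENNReal.one_lt_top).ne hb hd hb' hd' hT.le
  have e := tsum_add_tsum_log (d := d) hb hA hd.nonneg hq1 hT.le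
  have e' := tsum_add_tsum_log (d := d') hb' hA' hd'.nonneg (hd'.le_one hD' ht') hT.le
  have hdiff : 0 ≤ Real.log (T + 1) - Real.log T :=
    sub_nonneg.2 (Real.log_le_log hT (by linarith))
  have hK : ∑' x, ENNReal.ofReal
        (overlap b d x * (p x.1 * (Real.log (T + 1) - Real.log (p x.1 + T * q x.2)))) ≤
      ∑' x, ENNReal.ofReal (overlap b d x * (p x.1 * -Real.log (q x.2))) +
          ENNReal.ofReal (Real.log (T + 1) - Real.log T) := by
    have h1 : ∑' x, ENNReal.ofReal (overlap b d x * (p x.1 * (Real.log (T + 1) - Real.log T))) =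
        ENNReal.ofReal (Real.log (T + 1) - Real.log T) := by
      rw [tsum_ofReal_overlap_mul_fst b d fun i => p i * (Real.log (T + 1) - Real.log T)]
      simp only [ENNReal.ofReal_mul (hb.nonneg _)]
      rw [ENNReal.tsum_mul_right, ← hb.trace_eq_tsum hA.isPositive, hA.trace_eq_one, one_mul]
    rw [← h1, ← ENNReal.tsum_add]
    refine ENNReal.tsum_le_tsum fun x => ?_
    rcases (hd.nonneg x.2).eq_or_lt with hq | hq
    · have := h0 x hq.symm
      rw [← mul_assoc, this]
      simp
    have hp := hb.nonneg x.1
    have hw := overlap_nonneg b d x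
    have hlog := Real.log_nonpos hq.le (hq1 x.2)
    rw [← ENNReal.ofReal_add (mul_nonneg hw (mul_nonneg hp (neg_nonneg.2 hlog)))
      (mul_nonneg hw (mul_nonneg hp hdiff)), ← mul_add, ← mul_add]
    have h2 : Real.log T + Real.log (q x.2) ≤ Real.log (p x.1 + T * q x.2) := by
      rw [← Real.log_mul hT.ne' hq.ne']
      exact Real.log_le_log (mul_pos hT hq) (by linarith)
    refine ENNReal.ofReal_le_ofReal ?_
    gcongr
    linarith
  refine le_trans ?_ (add_le_add le_rfl hK)
  -- Adding the finite `log (T + 1)` to both sides allows both entropies to be replaced through `e`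
  -- and `e'`; the two complements then occur on both sides and `hG` remains.
  refine (ENNReal.add_le_add_iff_left (ENNReal.ofReal_ne_top (r := Real.log (T + 1)))).1 ?_
  rw [← add_assoc, ← add_assoc, ← e, ← e', add_assoc, add_assoc,
    add_comm (∑' x, _ : ENNReal) (∑' x, _)]
  exact add_le_add hG le_rfl

/-- Relative entropy decreases from `(A, D)` to `(A', D')`, in an additive form that is meaningful
for infinite entropies. -/
theorem Dominates.entropy_add_crossEntropy_le (h : Dominates A D A' D') (hA : IsState A)
    (hD : D.IsPositive) (hA' : IsState A') (hD' : D'.IsPositive)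
    (ht : trace D ≤ 1) (ht' : trace D' ≤ 1)
    (hd : IsEigenbasis D d q) (hd' : IsEigenbasis D' d' q') {l : ℝ} (hl : 0 < l)
    (hle : ∀ x, l * (⟪x, A x⟫_ℂ).re ≤ (⟪x, D x⟫_ℂ).re)
    (hle' : ∀ x, l * (⟪x, A' x⟫_ℂ).re ≤ (⟪x, D' x⟫_ℂ).re) :
    entropy A + crossEntropy A' d' q' ≤ entropy A' + crossEntropy A d q := by
  obtain ⟨ι, b, p, hb⟩ := hA.exists_isEigenbasis
  obtain ⟨ι', b', p', hb'⟩ := hA'.exists_isEigenbasis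
  rw [hb.entropy_eq_tsum hA.isPositive hA.trace_eq_one.le,
    hb'.entropy_eq_tsum hA'.isPositive hA'.trace_eq_one.le,
    crossEntropy_eq_tsum_overlap hA.isPositive hb d hd.nonneg (hd.le_one hD ht),
    crossEntropy_eq_tsum_overlap hA'.isPositive hb' d' hd'.nonneg (hd'.le_one hD' ht'),
    ← mul_add, ← mul_add]
  gcongr ENNReal.ofReal (Real.log 2)⁻¹ * ?_
  -- With a finite partial sum on the left, the limit `ε → 0` can be taken term by term.
  rw [ENNReal.tsum_eq_iSup_sum (f := fun x => ENNReal.ofReal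
    (overlap b' d' x * (p' x.1 * -Real.log (q' x.2)))), ENNReal.add_iSup]
  refine iSup_le fun E => ?_
  have key : ∀ ε ∈ Set.Ioi (0 : ℝ), ∑' i, ENNReal.ofReal (Real.negMulLog (p i)) +
      ∑ x ∈ E, ENNReal.ofReal (overlap b' d' x * (p' x.1 * -Real.log (q' x.2 + ε * p' x.1))) ≤
      ∑' i, ENNReal.ofReal (Real.negMulLog (p' i)) +
        (∑' x, ENNReal.ofReal (overlap b d x * (p x.1 * -Real.log (q x.2))) +
          ENNReal.ofReal (Real.log (1 + ε))) := by
    intro ε hε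
    have hε : 0 < ε := hε
    -- The choice `T = ε⁻¹` turns the error `log (T + 1) - log T` into `log (1 + ε)`.
    have h1 := h.tsum_negMulLog_add_le hA hD hA' hD' ht ht' hb hd hb' hd' (inv_pos.2 hε)
      (hb.mul_overlap_eq_zero hA.isPositive hd hl hle)
    have h2 : Real.log (ε⁻¹ + 1) - Real.log ε⁻¹ = Real.log (1 + ε) := by
      rw [← Real.log_div (by positivity) (by positivity)]
      congr 1
      field_simp
    rw [h2] at h1
    refine le_trans (add_le_add le_rfl ?_) h1
    refine le_trans (Finset.sum_le_sum fun x _ => ENNReal.ofReal_le_ofReal ?_)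
      (ENNReal.sum_le_tsum E)
    rcases (hb'.nonneg x.1).eq_or_lt with h3 | h3
    · simp [← h3]
    have hq := hd'.nonneg x.2
    refine mul_le_mul_of_nonneg_left (mul_le_mul_of_nonneg_left ?_ h3.le) (overlap_nonneg _ _ _)
    have h4 : p' x.1 + ε⁻¹ * q' x.2 = ε⁻¹ * (q' x.2 + ε * p' x.1) := by field_simp; ring
    have h5 : 0 < q' x.2 + ε * p' x.1 := by positivity
    have h6 : Real.log ε⁻¹ ≤ Real.log (ε⁻¹ + 1) := Real.log_le_log (by positivity) (by linarith)
    rw [h4, Real.log_mul (by positivity) h5.ne']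
    linarith
  have hl1 : Filter.Tendsto (fun ε : ℝ => ∑' i, ENNReal.ofReal (Real.negMulLog (p i)) +
      ∑ x ∈ E, ENNReal.ofReal (overlap b' d' x * (p' x.1 * -Real.log (q' x.2 + ε * p' x.1))))
      (nhdsWithin 0 (Set.Ioi 0)) (nhds (∑' i, ENNReal.ofReal (Real.negMulLog (p i)) +
      ∑ x ∈ E, ENNReal.ofReal (overlap b' d' x * (p' x.1 * -Real.log (q' x.2))))) := by
    refine (tendsto_finsetSum E fun x _ => ?_).const_add _
    refine Filter.Tendsto.mono_left ?_ nhdsWithin_le_nhds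
    rcases (hd'.nonneg x.2).eq_or_lt with hq | hq
    · have h1 := hb'.mul_overlap_eq_zero hA'.isPositive hd' hl hle' x hq.symm
      simp only [← mul_assoc, h1, zero_mul]
      exact tendsto_const_nhds
    · have h2 : ContinuousAt (fun ε : ℝ => ENNReal.ofReal
          (overlap b' d' x * (p' x.1 * -Real.log (q' x.2 + ε * p' x.1)))) 0 := by
        refine ENNReal.continuous_ofReal.continuousAt.comp ?_
        refine continuousAt_const.mul (continuousAt_const.mul (ContinuousAt.neg ?_))
        exact ContinuousAt.log (by fun_prop) (by simpa using hq.ne')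
      simpa only [ContinuousAt, zero_mul, add_zero] using h2
  have hl2 : Filter.Tendsto (fun ε : ℝ => ∑' i, ENNReal.ofReal (Real.negMulLog (p' i)) +
        (∑' x, ENNReal.ofReal (overlap b d x * (p x.1 * -Real.log (q x.2))) +
          ENNReal.ofReal (Real.log (1 + ε)))) (nhdsWithin 0 (Set.Ioi 0))
      (nhds (∑' i, ENNReal.ofReal (Real.negMulLog (p' i)) +
        (∑' x, ENNReal.ofReal (overlap b d x * (p x.1 * -Real.log (q x.2))) + 0))) := by
    refine (Filter.Tendsto.const_add _ ?_).const_add _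
    refine Filter.Tendsto.mono_left ?_ nhdsWithin_le_nhds
    have h2 : ContinuousAt (fun ε : ℝ => ENNReal.ofReal (Real.log (1 + ε))) 0 :=
      ENNReal.continuous_ofReal.continuousAt.comp (ContinuousAt.log (by fun_prop) (by simp))
    simpa only [ContinuousAt, add_zero, Real.log_one, ENNReal.ofReal_zero] using h2
  rw [add_zero] at hl2
  exact le_of_tendsto_of_tendsto hl1 hl2 (Filter.eventually_of_mem self_mem_nhdsWithin key)

end CrossEntropy

/-! ### Entropy of mixtures -/

section Mixture

variable {H : Type*} [NormedAddCommGroup H] [InnerProductSpace ℂ H] [CompleteSpace H]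
  {ι κ : Type*} {A D A₁ A₂ : H →L[ℂ] H} {d : HilbertBasis κ ℂ H} {q : κ → ℝ}

theorem re_inner_smul_apply (A : H →L[ℂ] H) (l : ℝ) (x : H) :
    (⟪x, ((l : ℂ) • A) x⟫_ℂ).re = l * (⟪x, A x⟫_ℂ).re := by
  rw [smul_apply, inner_smul_right, Complex.re_ofReal_mul]

theorem re_inner_mix (A₁ A₂ : H →L[ℂ] H) (l m : ℝ) (x : H) :
    (⟪x, ((l : ℂ) • A₁ + (m : ℂ) • A₂) x⟫_ℂ).re =
      l * (⟪x, A₁ x⟫_ℂ).re + m * (⟪x, A₂ x⟫_ℂ).re := by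
  rw [add_apply, inner_add_right, Complex.add_re, re_inner_smul_apply, re_inner_smul_apply]

theorem isPositive_ofReal_smul (hA : A.IsPositive) {l : ℝ} (hl : 0 ≤ l) :
    ((l : ℂ) • A).IsPositive :=
  hA.smul_of_nonneg (Complex.zero_le_real.2 hl)

theorem IsState.mix (h₁ : IsState A₁) (h₂ : IsState A₂) {l m : ℝ} (hl : 0 ≤ l) (hm : 0 ≤ m)
    (hlm : l + m = 1) : IsState ((l : ℂ) • A₁ + (m : ℂ) • A₂) := by
  refine ⟨(isPositive_ofReal_smul h₁.isPositive hl).add (isPositive_ofReal_smul h₂.isPositive hm),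
    ?_⟩
  have e : ∀ x, ENNReal.ofReal (⟪x, ((l : ℂ) • A₁ + (m : ℂ) • A₂) x⟫_ℂ).re =
      ENNReal.ofReal l * ENNReal.ofReal (⟪x, A₁ x⟫_ℂ).re +
        ENNReal.ofReal m * ENNReal.ofReal (⟪x, A₂ x⟫_ℂ).re := fun x => by
    rw [re_inner_mix, ENNReal.ofReal_add (mul_nonneg hl (h₁.re_inner_nonneg x))
      (mul_nonneg hm (h₂.re_inner_nonneg x)), ENNReal.ofReal_mul hl,
      ENNReal.ofReal_mul hm]
  have t₁ := h₁.trace_eq_one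
  have t₂ := h₂.trace_eq_one
  rw [trace] at t₁ t₂ ⊢
  simp only [e]
  rw [ENNReal.tsum_add, ENNReal.tsum_mul_left, ENNReal.tsum_mul_left, t₁, t₂, mul_one, mul_one,
    ← ENNReal.ofReal_add hl hm, hlm, ENNReal.ofReal_one]

/-- The eigenvalue `q j` is the diagonal entry of the mixture at `d j`, hence the mixture of the
diagonal entries of `A₁` and `A₂`. -/
theorem crossEntropy_mix (h₁ : IsState A₁) (h₂ : IsState A₂) {l m : ℝ} (hl : 0 ≤ l) (hm : 0 ≤ m)
    (hlm : l + m = 1) (hd : IsEigenbasis ((l : ℂ) • A₁ + (m : ℂ) • A₂) d q) :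
    ENNReal.ofReal l * crossEntropy A₁ d q + ENNReal.ofReal m * crossEntropy A₂ d q =
      entropy ((l : ℂ) • A₁ + (m : ℂ) • A₂) := by
  have hD := h₁.mix h₂ hl hm hlm
  have hq1 := hd.le_one hD.isPositive hD.trace_eq_one.le
  rw [hd.entropy_eq_tsum hD.isPositive hD.trace_eq_one.le, crossEntropy, crossEntropy,
    mul_left_comm, mul_left_comm (ENNReal.ofReal m), ← mul_add, ← ENNReal.tsum_mul_left,
    ← ENNReal.tsum_mul_left, ← ENNReal.tsum_add]
  congr 1
  refine tsum_congr fun j => ?_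
  have hlog : 0 ≤ -Real.log (q j) := neg_nonneg.2 (Real.log_nonpos (hd.nonneg j) (hq1 j))
  have e := re_inner_mix A₁ A₂ l m (d j)
  rw [re_inner_eigenvector hd.apply_eq] at e
  have n₁ := mul_nonneg hlog (h₁.re_inner_nonneg (d j))
  have n₂ := mul_nonneg hlog (h₂.re_inner_nonneg (d j))
  rw [← ENNReal.ofReal_mul hl, ← ENNReal.ofReal_mul hm,
    ← ENNReal.ofReal_add (mul_nonneg hl n₁) (mul_nonneg hm n₂), Real.negMulLog]
  congr 1
  nth_rw 3 [e]
  ring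

/-- An instance of the monotonicity of the logarithm: `l A ≤ D` gives `-Tr A log₂ D ≤ -Tr A log₂ (l
A) = S(A) - log₂ l`. -/
theorem crossEntropy_ne_top (hA : IsState A) (hD : IsState D) (hd : IsEigenbasis D d q)
    {l : ℝ} (hl : 0 < l) (hl1 : l ≤ 1)
    (hle : ∀ x, l * (⟪x, A x⟫_ℂ).re ≤ (⟪x, D x⟫_ℂ).re) (hS : entropy A ≠ ⊤) :
    crossEntropy A d q ≠ ⊤ := by
  obtain ⟨ι, b, p, hb⟩ := hA.exists_isEigenbasis
  have hlA := isPositive_ofReal_smul hA.isPositive hl.le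
  have hlb : IsEigenbasis ((l : ℂ) • A) b fun i => l * p i :=
    ⟨fun i => mul_nonneg hl.le (hb.nonneg i), fun i => by
      rw [smul_apply, hb.apply_eq, smul_smul, Complex.ofReal_mul]⟩
  have hlt : trace ((l : ℂ) • A) ≤ 1 := by
    rw [hlb.trace_eq_tsum hlA, ← hA.trace_eq_one, hb.trace_eq_tsum hA.isPositive]
    exact ENNReal.tsum_le_tsum fun i =>
      ENNReal.ofReal_le_ofReal (mul_le_of_le_one_left (hb.nonneg i) hl1)
  -- Here `Y = X` works: the first traces coincide, and the second are ordered because `l A ≤ D`.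
  have hdom : Dominates A ((l : ℂ) • A) A D := fun X _ => by
    refine ⟨X, le_rfl, ENNReal.tsum_le_tsum fun i => ENNReal.ofReal_le_ofReal ?_⟩
    simp only [ContinuousLinearMap.comp_apply, ContinuousLinearMap.adjoint_inner_right]
    rw [re_inner_smul_apply]
    exact hle _
  have h1 := hdom.entropy_add_crossEntropy_le hA hlA hA hD.isPositive hlt hD.trace_eq_one.le
    hlb hd hl (fun x => (re_inner_smul_apply A l x).ge) hle
  have h2 : crossEntropy A d q ≤ crossEntropy A b fun i => l * p i :=
    (ENNReal.add_le_add_iff_left hS).1 h1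
  refine ne_top_of_le_ne_top ?_ h2
  have hlog : 0 ≤ -Real.log l := neg_nonneg.2 (Real.log_nonpos hl.le hl1)
  have h3 : ∀ i, ENNReal.ofReal (-Real.log (l * p i) * (⟪b i, A (b i)⟫_ℂ).re) =
      ENNReal.ofReal (Real.negMulLog (p i)) +
        ENNReal.ofReal (-Real.log l) * ENNReal.ofReal (p i) := fun i => by
    rw [re_inner_eigenvector hb.apply_eq, ← ENNReal.ofReal_mul hlog, ← ENNReal.ofReal_add
      (Real.negMulLog_nonneg (hb.nonneg i) (hb.le_one hA.isPositive hA.trace_eq_one.le i))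
      (mul_nonneg hlog (hb.nonneg i))]
    congr 1
    rcases (hb.nonneg i).eq_or_lt with h0 | h0
    · simp [← h0]
    · rw [Real.log_mul hl.ne' h0.ne', Real.negMulLog]
      ring
  rw [crossEntropy]
  simp only [h3]
  rw [ENNReal.tsum_add, ENNReal.tsum_mul_left, ← hb.trace_eq_tsum hA.isPositive, hA.trace_eq_one,
    mul_add, ← hb.entropy_eq_tsum hA.isPositive hA.trace_eq_one.le, mul_one]
  exact ENNReal.add_ne_top.2 ⟨hS, ENNReal.mul_ne_top ENNReal.ofReal_ne_top ENNReal.ofReal_ne_top⟩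

theorem entropy_mix_ne_top (h₁ : IsState A₁) (h₂ : IsState A₂) {l m : ℝ} (hl : 0 < l) (hm : 0 < m)
    (hlm : l + m = 1) (hS₁ : entropy A₁ ≠ ⊤) (hS₂ : entropy A₂ ≠ ⊤) :
    entropy ((l : ℂ) • A₁ + (m : ℂ) • A₂) ≠ ⊤ := by
  have hD := h₁.mix h₂ hl.le hm.le hlm
  obtain ⟨κ, d, q, hd⟩ := hD.exists_isEigenbasis
  rw [← crossEntropy_mix h₁ h₂ hl.le hm.le hlm hd]
  refine ENNReal.add_ne_top.2 ⟨ENNReal.mul_ne_top ENNReal.ofReal_ne_top ?_,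
    ENNReal.mul_ne_top ENNReal.ofReal_ne_top ?_⟩
  · refine crossEntropy_ne_top h₁ hD hd hl (by linarith) (fun x => ?_) hS₁
    rw [re_inner_mix]
    have := mul_nonneg hm.le (h₂.re_inner_nonneg x)
    linarith
  · refine crossEntropy_ne_top h₂ hD hd hm (by linarith) (fun x => ?_) hS₂
    rw [re_inner_mix]
    have := mul_nonneg hl.le (h₁.re_inner_nonneg x)
    linarith

end Mixture

/-! ### Concavity of the conditional entropy -/

section PartialTrace

variable {C B : Type*} [NormedAddCommGroup C] [InnerProductSpace ℂ C] [CompleteSpace C]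
  [NormedAddCommGroup B] [InnerProductSpace ℂ B] [CompleteSpace B]
  {ρ ρ₁ ρ₂ σ : HilbertTensor C B →L[ℂ] HilbertTensor C B}

theorem exists_isAmplification {X : B →L[ℂ] B} (hX : X ∈ finiteRank B) :
    ∃ Y : HilbertTensor C B →L[ℂ] HilbertTensor C B, IsAmplification X Y := by
  induction hX using Submodule.span_induction with
  | mem X h =>
    obtain ⟨y, z, rfl⟩ := h
    exact ⟨_, IsAmplification.rankOne y z⟩
  | zero => exact ⟨1 - 1, by simpa using (IsAmplification.one (C := C) (B := B)).sub .one⟩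
  | add X Y _ _ hX hY =>
    obtain ⟨X', hX⟩ := hX
    obtain ⟨Y', hY⟩ := hY
    exact ⟨_, hX.add hY⟩
  | smul a X _ hX =>
    obtain ⟨X', hX⟩ := hX
    exact ⟨_, hX.smul a⟩

/-- The witness is `1 ⊗ X`, for which both trace inequalities are equalities. -/
theorem dominates_partialTrace (hρ : IsState ρ) (hσ : IsState σ) :
    Dominates ρ σ (partialTrace ρ) (partialTrace σ) := fun X hX => by
  obtain ⟨Y, hY⟩ := exists_isAmplification (C := C) hX
  exact ⟨Y, (hY.trace_conj_adjoint hρ).le, ((IsAmplification.one.sub hY).trace_adjoint_conj hσ).le⟩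

theorem partialTrace_mix (h₁ : IsState ρ₁) (h₂ : IsState ρ₂) (l m : ℂ) :
    partialTrace (l • ρ₁ + m • ρ₂) = l • partialTrace ρ₁ + m • partialTrace ρ₂ := by
  have s₁ := (hasSum_partialTrace h₁.isPositive h₁.trace_ne_top (stdBasis C))
  have s₂ := (hasSum_partialTrace h₂.isPositive h₂.trace_ne_top (stdBasis C))
  rw [← ((s₁.const_smul l).add (s₂.const_smul m)).tsum_eq, partialTrace]
  refine tsum_congr fun i => ?_
  ext y
  simp [compress]

/-- The concavity of the conditional entropy, as an inequality in `[0, ∞]` between entropies. -/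
theorem entropy_add_entropy_partialTrace_le (h₁ : IsState ρ₁) (h₂ : IsState ρ₂) {l m : ℝ}
    (hl : 0 < l) (hm : 0 < m) (hlm : l + m = 1) :
    ENNReal.ofReal l * entropy ρ₁ + ENNReal.ofReal m * entropy ρ₂ +
        entropy (partialTrace ((l : ℂ) • ρ₁ + (m : ℂ) • ρ₂)) ≤
      ENNReal.ofReal l * entropy (partialTrace ρ₁) + ENNReal.ofReal m * entropy (partialTrace ρ₂) +
        entropy ((l : ℂ) • ρ₁ + (m : ℂ) • ρ₂) := by
  have hρ := h₁.mix h₂ hl.le hm.le hlm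
  have hρ' := h₁.partialTrace.mix h₂.partialTrace hl.le hm.le hlm
  have d₁ := dominates_partialTrace h₁ hρ
  have d₂ := dominates_partialTrace h₂ hρ
  rw [partialTrace_mix h₁ h₂] at d₁ d₂ ⊢
  obtain ⟨κ, d, q, hd⟩ := hρ.exists_isEigenbasis
  obtain ⟨κ', d', q', hd'⟩ := hρ'.exists_isEigenbasis
  rw [← crossEntropy_mix h₁ h₂ hl.le hm.le hlm hd,
    ← crossEntropy_mix h₁.partialTrace h₂.partialTrace hl.le hm.le hlm hd']
  have i₁ := d₁.entropy_add_crossEntropy_le h₁ hρ.isPositive h₁.partialTrace hρ'.isPositive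
    hρ.trace_eq_one.le hρ'.trace_eq_one.le hd hd' hl
    (fun x => by
      rw [re_inner_mix]
      exact le_add_of_nonneg_right (mul_nonneg hm.le (h₂.re_inner_nonneg x)))
    (fun x => by
      rw [re_inner_mix]
      exact le_add_of_nonneg_right
        (mul_nonneg hm.le (h₂.partialTrace.re_inner_nonneg x)))
  have i₂ := d₂.entropy_add_crossEntropy_le h₂ hρ.isPositive h₂.partialTrace hρ'.isPositive
    hρ.trace_eq_one.le hρ'.trace_eq_one.le hd hd' hm
    (fun x => by
      rw [re_inner_mix]
      exact le_add_of_nonneg_left (mul_nonneg hl.le (h₁.re_inner_nonneg x)))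
    (fun x => by
      rw [re_inner_mix]
      exact le_add_of_nonneg_left
        (mul_nonneg hl.le (h₁.partialTrace.re_inner_nonneg x)))
  have i := add_le_add (mul_le_mul_right i₁ (ENNReal.ofReal l))
    (mul_le_mul_right i₂ (ENNReal.ofReal m))
  rw [mul_add, mul_add, mul_add, mul_add, add_add_add_comm,
    add_add_add_comm (_ * entropy (partialTrace ρ₁))] at i
  exact i

/-- Passage from the additive inequality to differences in `EReal`. The hypothesis `ht` excludes the
one bad case, a right-hand side `⊥` with `t₁` and `t₂` finite. -/
theorem mul_sub_add_mul_sub_le {s₁ s₂ s t₁ t₂ t : ENNReal} {l m : ℝ} (hl : 0 < l) (hm : 0 < m)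
    (ht : t₁ ≠ ⊤ → t₂ ≠ ⊤ → t ≠ ⊤)
    (h : ENNReal.ofReal l * s₁ + ENNReal.ofReal m * s₂ + t ≤
      ENNReal.ofReal l * t₁ + ENNReal.ofReal m * t₂ + s) :
    (l : EReal) * ((s₁ : EReal) - t₁) + (m : EReal) * ((s₂ : EReal) - t₂) ≤ (s : EReal) - t := by
  -- Subtracting `⊤` gives `⊥` even from `⊤`, and `⊥` absorbs the other summand.
  by_cases h₁ : t₁ = ⊤
  · simp [h₁, EReal.coe_mul_bot_of_pos hl]
  by_cases h₂ : t₂ = ⊤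
  · simp [h₂, EReal.coe_mul_bot_of_pos hm]
  have h₀ := ht h₁ h₂
  by_cases hs : s = ⊤
  · lift t to NNReal using h₀
    rw [hs, EReal.coe_ennreal_top, EReal.top_sub (by simp)]
    exact le_top
  have hfin : ENNReal.ofReal l * t₁ + ENNReal.ofReal m * t₂ + s ≠ ⊤ := by
    simp [ENNReal.mul_ne_top, h₁, h₂, hs]
  have hfin' := ne_top_of_le_ne_top hfin h
  have hs₁ : s₁ ≠ ⊤ := by
    rintro rfl
    simp [ENNReal.mul_top, hl] at hfin'
  have hs₂ : s₂ ≠ ⊤ := by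
    rintro rfl
    simp [ENNReal.mul_top, hm] at hfin'
  have h' := (ENNReal.toReal_le_toReal hfin' hfin).2 h
  lift s₁ to NNReal using hs₁
  lift s₂ to NNReal using hs₂
  lift s to NNReal using hs
  lift t₁ to NNReal using h₁
  lift t₂ to NNReal using h₂
  lift t to NNReal using h₀
  rw [ENNReal.toReal_add (by finiteness) (by finiteness),
    ENNReal.toReal_add (by finiteness) (by finiteness),
    ENNReal.toReal_add (by finiteness) (by finiteness),
    ENNReal.toReal_add (by finiteness) (by finiteness)] at h'
  simp only [ENNReal.toReal_mul, ENNReal.toReal_ofReal hl.le, ENNReal.toReal_ofReal hm.le,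
    ENNReal.coe_toReal] at h'
  have hc : ∀ r : NNReal, ((r : ENNReal) : EReal) = ((r : ℝ) : EReal) := fun _ => rfl
  simp only [hc]
  norm_cast
  linarith

end PartialTrace

end QInfo

end

theorem mainTheorem4 {C B : Type*}
    [NormedAddCommGroup C] [InnerProductSpace ℂ C] [CompleteSpace C]
    [NormedAddCommGroup B] [InnerProductSpace ℂ B] [CompleteSpace B]
    (ρ₁ ρ₂ : QInfo.HilbertTensor C B →L[ℂ] QInfo.HilbertTensor C B)
    (h₁ : QInfo.IsState ρ₁) (h₂ : QInfo.IsState ρ₂)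
    (l : ℝ) (hl₀ : 0 ≤ l) (hl₁ : l ≤ 1) :
    (l : EReal) * QInfo.condEntropy ρ₁ + ((1 - l : ℝ) : EReal) * QInfo.condEntropy ρ₂ ≤
      QInfo.condEntropy ((l : ℂ) • ρ₁ + ((1 - l : ℝ) : ℂ) • ρ₂) := by
  -- The endpoints are separate because `l ρ₁ ≤ ρ` and `(1 - l) ρ₂ ≤ ρ` are used with positive
  -- constants.
  rcases hl₀.eq_or_lt with rfl | hl
  · simp
  rcases hl₁.eq_or_lt with rfl | hl'
  · simp
  have hm : 0 < 1 - l := sub_pos.2 hl'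
  refine QInfo.mul_sub_add_mul_sub_le hl hm (fun ht₁ ht₂ => ?_)
    (QInfo.entropy_add_entropy_partialTrace_le h₁ h₂ hl hm (by ring))
  rw [QInfo.partialTrace_mix h₁ h₂]
  exact QInfo.entropy_mix_ne_top h₁.partialTrace h₂.partialTrace hl hm (by ring) ht₁ ht₂
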